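/- Let $m,p\ge 1$. A $p$-periodic $m\times m$ matrix-valued Jacobi operator $\mathcal J$ is the bounded self-adjoint operator on $\ell^2(\mathbb Z)^m$ given by $$(\mathcal Jy)_n=a_ny_{n+1}+b_ny_n+a_{n-1}^{\top}y_{n-1},\qquad n\in\mathbb Z,$$ where $a_n$ and $b_n=b_n^{\top}$ are $p$-periodic sequences of real $m\times m$ matrices with $\det a_n\neq0$. Let $\varphi_n(z),\vartheta_n(z)$ be the $m\times m$ matrix solutions of $a_ny_{n+1}+b_ny_n+a_{n-1}^\top y_{n-1}=zy_n$ with $\varphi_0=\vartheta_1=0$, $\varphi_1=\vartheta_0=I_m$, and put $$\mathscr M_p=\begin{pmatrix}\vartheta_p&\varphi_p\\ \vartheta_{p+1}&\varphi_{p+1}\end{pmatrix},\quad P_0=\begin{pmatrix}a_0&0\\0&I_m\end{pmatrix},\quad M=P_0\mathscr M_pP_0^{-1},\quad D(z,\tau)=\det(M(z)-\tau I_{2m}).$$ The $2m$ eigenvalues of $M(z)$, counted with algebraic multiplicity, have the form $\tau_j(z)^{\pm1}$, $1\le j\le m$; the Lyapunov functions are $\Delta_j=\frac12(\tau_j+\tau_j^{-1})$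 (determined, at each $z$, up to their numbering). Let $\Lambda(\tau)$ be the collection of the zeros of the polynomial $D(\cdot,\tau)$, counted with multiplicity. The multiplicity of the spectrum at $z\in\mathbb C$ is the dimension of the space of bounded sequences $(y_n)_{n\in\mathbb Z}$ in $\mathbb C^m$ with $a_ny_{n+1}+b_ny_n+a_{n-1}^\top y_{n-1}=zy_n$ for all $n$. All collections below are multisets, and inclusion and cardinality take multiplicities into account. Let $\varkappa_0,\dots,\varkappa_m\in\mathbb R$ have pairwise distinct cosines. (i) Let $\Lambda_0=\Lambda(e^{i\varkappa_0})$ and $\Lambda_j\subset\Lambda(e^{i\varkappa_j})$ with $\#\Lambda_j=(m-j)p+1$, $j=1,\dots,m$, for some Jacobi operator $\mathcal J$. Then the data $\Lambda_0,\dots,\Lambda_m$ determine $D(\cdot,\cdot)$, all the Lyapunov functions $\Delta_1,\dots,\Delta_m$, and the spectrum $\sigma(\mathcal J)$ together with its multiplicity: any two $p$-periodic $m\times m$ Jacobi operators for which $\Lambda_0,\dots,\Lambda_m$ are such data have the same $D$, the same Lyapunov functions, the same spectrum, and the same multiplicity of the spectrum at every point. (ii) The number of data in (i) cannot be lowered by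 one: for all $m,p\ge1$ and all $\varkappa_0,\dots,\varkappa_m$ as above there are data $\Lambda_0,\dots,\Lambda_m$ as in (i), arising from some Jacobi operator, and $\widetilde\Lambda_1\subset\Lambda_1$ with $\#\widetilde\Lambda_1=\#\Lambda_1-1$, such that the Jacobi operators with $\Lambda(e^{i\varkappa_0})=\Lambda_0$, $\widetilde\Lambda_1\subset\Lambda(e^{i\varkappa_1})$ and $\Lambda_j\subset\Lambda(e^{i\varkappa_j})$ for $j=2,\dots,m$ have infinitely many different determinants $D$. -/

import Mathlib

open scoped Matrix

/-- A `p`-periodic matrix-valued Jacobi operator is given by `p`-periodic two-sided sequences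
`a n`, `b n` of real `m × m` matrices, with `b n` symmetric and `a n` invertible. -/
structure PeriodicJacobi (m p : ℕ) where
  a : ℤ → Matrix (Fin m) (Fin m) ℝ
  b : ℤ → Matrix (Fin m) (Fin m) ℝ
  a_periodic : ∀ n, a (n + p) = a n
  b_periodic : ∀ n, b (n + p) = b n
  b_symm : ∀ n, (b n)ᵀ = b n
  a_det : ∀ n, (a n).det ≠ 0

namespace PeriodicJacobi

noncomputable section

variable {m p : ℕ}

/-! ### The operator on `ℓ²(ℤ)^m` -/

/-- The action of a real `m × m` matrix on `ℂ^m`. -/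
def act (A : Matrix (Fin m) (Fin m) ℝ) :
    EuclideanSpace ℂ (Fin m) →L[ℂ] EuclideanSpace ℂ (Fin m) :=
  Matrix.toEuclideanCLM (n := Fin m) (𝕜 := ℂ) (A.map (algebraMap ℝ ℂ))

/-- The Jacobi difference expression `(J y)_n = a_n y_{n+1} + b_n y_n + a_{n-1}ᵀ y_{n-1}` on
arbitrary sequences `y : ℤ → ℂ^m`. -/
def diffExpr (J : PeriodicJacobi m p) (y : ℤ → EuclideanSpace ℂ (Fin m)) :
    ℤ → EuclideanSpace ℂ (Fin m) :=
  fun n => act (J.a n) (y (n + 1)) + act (J.b n) (y n) + act (J.a (n - 1))ᵀ (y (n - 1))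

/-- The Hilbert space `ℓ²(ℤ)^m = ℓ²(ℤ; ℂ^m)`. -/
abbrev SeqSpace (m : ℕ) : Type := lp (fun _ : ℤ => EuclideanSpace ℂ (Fin m)) 2

/-- The shift `(S_k y)_n = y_{n+k}` on `ℓ²(ℤ)^m`. -/
def shift (m : ℕ) (k : ℤ) : SeqSpace m →L[ℂ] SeqSpace m :=
  LinearMap.mkContinuous
    { toFun := fun y => ⟨fun n => y (n + k), by
        have h := (memℓp_gen_iff (p := 2) (by norm_num)).1 (lp.memℓp y)
        exact memℓp_gen ((Equiv.addRight k).summable_iff.2 h)⟩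
      map_add' := fun _ _ => rfl
      map_smul' := fun _ _ => rfl } 1 (fun y => by
    have h2 : (0 : ℝ) < (2 : ENNReal).toReal := by norm_num
    refine lp.norm_le_of_tsum_le h2 (by positivity) ?_
    rw [one_mul, lp.norm_rpow_eq_tsum h2 y]
    exact ((Equiv.addRight k).tsum_eq (fun n => ‖y n‖ ^ (2 : ENNReal).toReal)).le)

theorem shift_apply (k : ℤ) (y : SeqSpace m) (n : ℤ) : shift m k y n = y (n + k) := rfl

/-- The entries of a periodic sequence of matrices act with uniformly bounded norms. -/
theorem exists_bound [NeZero p] {c : ℤ → Matrix (Fin m) (Fin m) ℝ}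
    (hc : ∀ n, c (n + p) = c n) : ∃ K : ℝ, 0 ≤ K ∧ ∀ n, ‖act (c n)‖ ≤ K := by
  have hmod : ∀ n : ℤ, c (n % p) = c n := fun n => by
    have h := (show Function.Periodic c (p : ℤ) from hc).int_mul (n / p) (n % p)
    rw [← h]
    congr 1
    have := Int.emod_add_mul_ediv n p
    simp only [Int.cast_id]
    linarith [mul_comm (n / (p : ℤ)) (p : ℤ)]
  refine ⟨∑ i ∈ Finset.Ico (0 : ℤ) p, ‖act (c i)‖, by positivity, fun n => ?_⟩
  rw [← hmod n]
  have hp : (0 : ℤ) < p := by exact_mod_cast Nat.pos_of_ne_zero (NeZero.ne p)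
  exact Finset.single_le_sum (f := fun i => ‖act (c i)‖) (fun i _ => norm_nonneg _)
    (Finset.mem_Ico.2 ⟨Int.emod_nonneg _ hp.ne', Int.emod_lt_of_pos _ hp⟩)

/-- Termwise application of a periodic sequence of matrices, as an operator on `ℓ²(ℤ)^m`. -/
def mulOp [NeZero p] (c : ℤ → Matrix (Fin m) (Fin m) ℝ) (hc : ∀ n, c (n + p) = c n) :
    SeqSpace m →L[ℂ] SeqSpace m :=
  lp.mapCLM 2 (fun n => act (c n)) (exists_bound hc).choose_spec.1 (exists_bound hc).choose_spec.2

theorem aT_periodic (J : PeriodicJacobi m p) (n : ℤ) :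
    (J.a (n + p - 1))ᵀ = (J.a (n - 1))ᵀ := by
  rw [← J.a_periodic (n - 1)]
  congr 2
  ring

/-- The Jacobi operator on `ℓ²(ℤ)^m`, as a bounded operator. -/
def op [NeZero p] (J : PeriodicJacobi m p) : SeqSpace m →L[ℂ] SeqSpace m :=
  mulOp J.a J.a_periodic ∘L shift m 1 + mulOp J.b J.b_periodic +
    mulOp (fun n => (J.a (n - 1))ᵀ) J.aT_periodic ∘L shift m (-1)

/-- The operator acts by the Jacobi difference expression. -/
theorem op_apply [NeZero p] (J : PeriodicJacobi m p) (y : SeqSpace m) (n : ℤ) :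
    J.op y n = J.diffExpr y n := rfl

/-- The solutions `y : ℤ → ℂ^m` of `a_n y_{n+1} + b_n y_n + a_{n-1}ᵀ y_{n-1} = z y_n`
(generalized eigenfunctions) which are bounded on `ℤ`. -/
def boundedSolutions (J : PeriodicJacobi m p) (z : ℂ) :
    Submodule ℂ (ℤ → EuclideanSpace ℂ (Fin m)) where
  carrier := {y | J.diffExpr y = z • y ∧ ∃ C : ℝ, ∀ n, ‖y n‖ ≤ C}
  zero_mem' := ⟨by ext; simp [diffExpr], 0, by simp⟩
  add_mem' := by
    rintro x y ⟨hx, C, hC⟩ ⟨hy, C', hC'⟩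
    refine ⟨?_, C + C', fun n => (norm_add_le _ _).trans (add_le_add (hC n) (hC' n))⟩
    rw [smul_add, ← hx, ← hy]
    funext n
    simp only [diffExpr, Pi.add_apply, map_add]
    abel
  smul_mem' := by
    rintro c y ⟨hy, C, hC⟩
    refine ⟨?_, ‖c‖ * C, fun n => ?_⟩
    · rw [smul_comm, ← hy]
      funext n
      simp only [diffExpr, Pi.smul_apply, map_smul, smul_add]
    · rw [Pi.smul_apply, norm_smul]
      exact mul_le_mul_of_nonneg_left (hC n) (norm_nonneg _)

/-- The multiplicity of the spectrum at `z`: the number of linearly independent bounded generalized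
eigenfunctions. Equivalently, the number of times the bands `λ_n(𝕊¹)`, `n = 1, …, mp`, cover `z`. -/
def multiplicity (J : PeriodicJacobi m p) (z : ℂ) : ℕ :=
  Module.finrank ℂ (J.boundedSolutions z)

/-! ### Fundamental solutions, monodromy matrix, determinant

These are defined for a spectral parameter `z` in any commutative `ℝ`-algebra `R`: `R = ℂ` gives the
values at complex `z`, and `R = ℂ[X]`, `z = X` gives the same objects as polynomials in `z`. -/

variable {R : Type*} [CommRing R] [Algebra ℝ R]

/-- The `m × m` matrix solution of `a_n y_{n+1} + b_n y_n + a_{n-1}ᵀ y_{n-1} = z y_n`, `n ≥ 1`, with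
initial values `y_0` and `y_1`. -/
def solution (J : PeriodicJacobi m p) (z : R) (y₀ y₁ : Matrix (Fin m) (Fin m) R) :
    ℕ → Matrix (Fin m) (Fin m) R
  | 0 => y₀
  | 1 => y₁
  | n + 2 =>
    (J.a (n + 1))⁻¹.map (algebraMap ℝ R) *
      ((z • 1 - (J.b (n + 1)).map (algebraMap ℝ R)) * solution J z y₀ y₁ (n + 1) -
        (J.a n)ᵀ.map (algebraMap ℝ R) * solution J z y₀ y₁ n)

/-- The fundamental solution `φ`, with `φ_0 = 0`, `φ_1 = 1`. -/
def phi (J : PeriodicJacobi m p) (z : R) : ℕ → Matrix (Fin m) (Fin m) R := J.solution z 0 1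

/-- The fundamental solution `ϑ`, with `ϑ_0 = 1`, `ϑ_1 = 0`. -/
def theta (J : PeriodicJacobi m p) (z : R) : ℕ → Matrix (Fin m) (Fin m) R := J.solution z 1 0

/-- The `2m × 2m` monodromy matrix `𝓜_p(z)`. -/
def monodromy (J : PeriodicJacobi m p) (z : R) : Matrix (Fin m ⊕ Fin m) (Fin m ⊕ Fin m) R :=
  Matrix.fromBlocks (J.theta z p) (J.phi z p) (J.theta z (p + 1)) (J.phi z (p + 1))

/-- The matrix `P₀ = a_0 ⊕ 1`. -/
def P₀ (J : PeriodicJacobi m p) : Matrix (Fin m ⊕ Fin m) (Fin m ⊕ Fin m) ℝ :=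
  Matrix.fromBlocks (J.a 0) 0 0 1

/-- The modified monodromy matrix `M(z) = P₀ 𝓜_p(z) P₀⁻¹`. -/
def modMonodromy (J : PeriodicJacobi m p) (z : R) : Matrix (Fin m ⊕ Fin m) (Fin m ⊕ Fin m) R :=
  J.P₀.map (algebraMap ℝ R) * J.monodromy z * J.P₀⁻¹.map (algebraMap ℝ R)

/-- The determinant `D(z, τ) = det (M(z) - τ)`. -/
def D (J : PeriodicJacobi m p) (z τ : R) : R := (J.modMonodromy z - τ • 1).det

theorem solution_map {S : Type*} [CommRing S] [Algebra ℝ S] (f : R →ₐ[ℝ] S)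
    (J : PeriodicJacobi m p) (z : R) (y₀ y₁ : Matrix (Fin m) (Fin m) R) (n : ℕ) :
    (J.solution z y₀ y₁ n).map f = J.solution (f z) (y₀.map f) (y₁.map f) n := by
  have hA : ∀ A : Matrix (Fin m) (Fin m) ℝ,
      (A.map (algebraMap ℝ R)).map f = A.map (algebraMap ℝ S) := fun A => by
    ext i j; simp
  induction n using Nat.twoStepInduction with
  | zero => rfl
  | one => rfl
  | more n ih₀ ih₁ =>
    have hz : (z • (1 : Matrix (Fin m) (Fin m) R)).map f = f z • 1 := by
      ext i j; simp [Matrix.one_apply, apply_ite f]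
    simp only [solution]
    rw [Matrix.map_mul, Matrix.map_sub _ (map_sub f), Matrix.map_mul, Matrix.map_mul,
      Matrix.map_sub _ (map_sub f), ih₀, ih₁, hz, hA, hA, hA]

/-- The formation of `D` commutes with homomorphisms. In particular `D(X, C τ)`, a polynomial, takes
the value `D(z, τ)` at `z`. -/
theorem D_map {S : Type*} [CommRing S] [Algebra ℝ S] (f : R →ₐ[ℝ] S)
    (J : PeriodicJacobi m p) (z τ : R) : f (J.D z τ) = J.D (f z) (f τ) := by
  have hA : ∀ A : Matrix (Fin m ⊕ Fin m) (Fin m ⊕ Fin m) ℝ,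
      (A.map (algebraMap ℝ R)).map f = A.map (algebraMap ℝ S) := fun A => by
    ext i j; simp
  have hM : (J.modMonodromy z).map f = J.modMonodromy (f z) := by
    have h : (J.monodromy z).map f = J.monodromy (f z) := by
      simp only [monodromy, theta, phi, Matrix.fromBlocks_map, solution_map,
        Matrix.map_zero f (map_zero f), Matrix.map_one f (map_zero f) (map_one f)]
    rw [modMonodromy, Matrix.map_mul, Matrix.map_mul, hA, hA, h, modMonodromy]
  have hτ : (τ • (1 : Matrix (Fin m ⊕ Fin m) (Fin m ⊕ Fin m) R)).map f = f τ • 1 := by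
    ext i j; simp [Matrix.one_apply, apply_ite f]
  rw [D, AlgHom.map_det, AlgHom.mapMatrix_apply, Matrix.map_sub _ (map_sub f), hM, hτ, D]

/-- `Λ(τ)`: the zeros of the polynomial `D(·, τ)`, with their multiplicities. -/
def zeros (J : PeriodicJacobi m p) (τ : ℂ) : Multiset ℂ :=
  (J.D (Polynomial.X : Polynomial ℂ) (Polynomial.C τ)).roots

theorem D_eval (J : PeriodicJacobi m p) (z τ : ℂ) :
    (J.D (Polynomial.X : Polynomial ℂ) (Polynomial.C τ)).eval z = J.D z τ := by
  have h := J.D_map ((Polynomial.aeval z).restrictScalars ℝ : Polynomial ℂ →ₐ[ℝ] ℂ)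
    Polynomial.X (Polynomial.C τ)
  simpa [Polynomial.coe_aeval_eq_eval] using h

/-- `Δ_1, …, Δ_m` are (an enumeration at each point `z` of) the Lyapunov functions: the `2m`
eigenvalues of `M(z)`, counted with algebraic multiplicity, are `τ_1^{±1}, …, τ_m^{±1}`, and
`Δ_j(z) = (τ_j + τ_j⁻¹) / 2`. -/
def IsLyapunov (J : PeriodicJacobi m p) (Δ : Fin m → ℂ → ℂ) : Prop :=
  ∀ z : ℂ, ∃ τ : Fin m → ℂ,
    (J.modMonodromy z).charpoly.roots =
      Finset.univ.val.map τ + Finset.univ.val.map (fun j => (τ j)⁻¹) ∧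
    ∀ j, Δ j z = (τ j + (τ j)⁻¹) / 2

/-- `Λ_0, …, Λ_m` are spectral data of `J` at `ϰ_0, …, ϰ_m`: `Λ_0` consists of all the zeros of
`D(·, e^{iϰ_0})`, and `Λ_j` of some of the zeros of `D(·, e^{iϰ_j})` for `j = 1, …, m`. -/
def HasData (J : PeriodicJacobi m p) (ϰ : Fin (m + 1) → ℝ) (Λ : Fin (m + 1) → Multiset ℂ) : Prop :=
  Λ 0 = J.zeros (Complex.exp (ϰ 0 * Complex.I)) ∧
    ∀ j, j ≠ 0 → Λ j ≤ J.zeros (Complex.exp (ϰ j * Complex.I))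

end

end PeriodicJacobi

/-!
The proof rests on the Floquet matrix `H(t)`, the `pm × pm` matrix of the difference expression on
sequences with `y_{n+p} = t y_n`. Elimination of the sites `2, …, p + 1` with the solutions `ϑ`,
`φ` gives `det (H(t) - z) = c t⁻ᵐ D(z, t)` with a constant `c ≠ 0` over every commutative
`ℝ`-algebra (`det_floquet_sub`). Transposition turns `H(t)` into `H(t⁻¹)`, and `H(t)` is Hermitian
for `|t| = 1`.

**Uniqueness of `D`.** By the symmetry `t ↦ t⁻¹` and degree bounds, `D(z, t) = tᵐ Φ(z, t + t⁻¹)`,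
where `Φ(z, ν)` is monic of degree `m` in `ν` and the coefficient of `ν ^ (m - j)` has degree at
most `jp` in `z` (`exists_reduced`). If two operators have the same data, the difference `Ψ` of
their polynomials `Φ`, normalized to be monic in `z`, vanishes at `ν_0 = 2 cos ϰ_0`, and at
`ν_j = 2 cos ϰ_j` it has `(m - j)p + 1` common zeros. Now `Ψ = (ν - ν_0) Ψ_1`, where `Ψ_1(·, ν_1)` has
degree at most `(m - 1)p` and so vanishes; by repetition `Ψ = 0` (`eq_zero_of_dvd_eval`). As both
`Φ` are monic in `ν`, the normalizing constants agree too (`D_eq_of_hasData`).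

**What `D` determines.** The Lyapunov functions are read off from the zeros of `D(z, ·)`. The shift
by `p` acts on the bounded solutions diagonalizably with eigenvalues on the unit circle. Its
eigenspace for `τ` is isomorphic to the kernel of the Hermitian matrix `H(τ) - z`, whose dimension
is the multiplicity of `z` as a zero of `D(·, τ)` (`multiplicity_eq_of_D_eq`). With the shift `S`
of `ℓ²(ℤ)` in place of `t`, the operator `𝓙 - z` is the matrix `H(S) - z` over the Laurent
polynomials in `S`; so its invertibility depends on the zeros of `D(z, ·)` on the unit circle
(`mem_spectrum_op_iff`).

**Sharpness.** For direct sums of one scalar operator, with constant off-diagonal coefficient `ε`,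
and `m - 1` copies of the free operator, the copies contribute `(m - 1)p` common zeros at each
`e^{iϰ_j}`. For small `ε` the diagonal coefficients of the scalar operator can be adapted such that
its zeros at `e^{iϰ_0}` are `0, …, p - 1` (`eventually_exists_charpoly_eq`), while different
`ε > 0` lead to different `D` (`exists_data_infinite`).
-/

/-! ### The Floquet matrix and its determinant -/

namespace PeriodicJacobi

noncomputable section

open Matrix Kronecker

variable {m p : ℕ} {R : Type*} [CommRing R]

/-- The `p × p` matrix of the cyclic shift `(y_0, …, y_{p-1}) ↦ (y_1, …, y_{p-1}, t y_0)`, that is,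
of the shift of sequences with the Bloch condition `y_{n+p} = t y_n`. -/
def cyc (p : ℕ) (t : R) : Matrix (Fin p) (Fin p) R :=
  Matrix.of fun r k =>
    if (k : ℕ) = r + 1 then 1 else if (r : ℕ) + 1 = p ∧ (k : ℕ) = 0 then t else 0

theorem sum_cyc_smul {H : Type*} [AddCommGroup H] [Module R H] (t : R) (r : Fin p)
    (f : Fin p → H) : ∑ k, cyc p t r k • f k =
      if h : (r : ℕ) + 1 < p then f ⟨r + 1, h⟩ else t • f ⟨0, r.pos⟩ := by
  split_ifs with h
  · rw [Finset.sum_eq_single ⟨r + 1, h⟩]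
    · simp [cyc]
    · rintro b - hb
      have : ¬ (b : ℕ) = r + 1 := fun h' => hb (Fin.ext h')
      have h3 : ¬ (r : ℕ) + 1 = p := by omega
      simp [cyc, this, h3]
    · simp
  · rw [Finset.sum_eq_single ⟨0, r.pos⟩]
    · have h3 : (r : ℕ) + 1 = p := by omega
      simp [cyc, h3, r.pos.ne]
    · rintro b - hb
      have : ¬ (b : ℕ) = r + 1 := by omega
      have h3 : ¬ (b : ℕ) = 0 := fun h' => hb (Fin.ext h')
      simp [cyc, this, h3]
    · simp

theorem sum_cyc_transpose_smul {H : Type*} [AddCommGroup H] [Module R H] (t : R) (r : Fin p)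
    (f : Fin p → H) : ∑ k, cyc p t k r • f k =
      if (r : ℕ) = 0 then t • f ⟨p - 1, Nat.sub_lt r.pos one_pos⟩
      else f ⟨r - 1, by omega⟩ := by
  split_ifs with h
  · rw [Finset.sum_eq_single ⟨p - 1, Nat.sub_lt r.pos one_pos⟩]
    · have h3 : p - 1 + 1 = p := Nat.sub_add_cancel r.pos
      simp [cyc, h, h3, r.pos.ne]
    · rintro b - hb
      have h3 : ¬ (b : ℕ) + 1 = p := fun h' => hb (Fin.ext (by simp; omega))
      simp [cyc, h, h3]
    · simp
  · rw [Finset.sum_eq_single ⟨r - 1, by omega⟩]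
    · have h3 : (r : ℕ) = r - 1 + 1 := by omega
      simp only [cyc, of_apply]
      rw [if_pos h3, one_smul]
    · rintro b - hb
      have h3 : ¬ (r : ℕ) = b + 1 := fun h' => hb (Fin.ext (by simp; omega))
      simp [cyc, h, h3]
    · simp

theorem cyc_mul_transpose {t t' : R} (ht : t * t' = 1) : cyc p t * (cyc p t')ᵀ = 1 := by
  ext r s
  have h := sum_cyc_smul t r (fun k => cyc p t' s k)
  simp only [smul_eq_mul] at h
  rw [mul_apply]
  simp only [transpose_apply, h]
  split_ifs with h1
  · by_cases hrs : r = s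
    · subst hrs; simp [cyc]
    · have : ¬ (r : ℕ) = s := fun h => hrs (Fin.ext h)
      simp [cyc, this, hrs]
  · by_cases hrs : r = s
    · subst hrs
      have : (r : ℕ) + 1 = p := by omega
      simp [cyc, this, ht, r.pos.ne]
    · have : ¬ (s : ℕ) + 1 = p := fun h => hrs (Fin.ext (by omega))
      simp [cyc, this, hrs]

theorem cyc_eq_diagonal_mul (t : R) :
    cyc p t = diagonal (fun r : Fin p => if (r : ℕ) + 1 = p then t else 1) * cyc p (1 : R) := by
  ext r k
  rw [diagonal_mul]
  by_cases h1 : (k : ℕ) = r + 1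
  · have : ¬ (r : ℕ) + 1 = p := by omega
    simp [cyc, h1, this]
  · by_cases h2 : (r : ℕ) + 1 = p
    · have h3 : ¬ (k : ℕ) = p := k.2.ne
      simp [cyc, h2, h3]
    · simp [cyc, h1, h2]

theorem det_cyc [NeZero p] (t : R) : (cyc p t).det = t * (cyc p (1 : R)).det := by
  have hp := Nat.pos_of_ne_zero (NeZero.ne p)
  rw [cyc_eq_diagonal_mul t, det_mul, det_diagonal]
  congr 1
  rw [Finset.prod_eq_single ⟨p - 1, by omega⟩]
  · have : p - 1 + 1 = p := by omega
    simp [this]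
  · rintro b - hb
    have h3 : ¬ (b : ℕ) + 1 = p := fun h' => hb (Fin.ext (by simp; omega))
    simp [h3]
  · simp

theorem cyc_map {S : Type*} [CommRing S] (f : R →+* S) (t : R) :
    (cyc p t).map f = cyc p (f t) := by
  ext r k
  simp only [cyc, map_apply, of_apply]
  split_ifs <;> simp

theorem cyc_kronecker_transpose_mulVec (s : R) (x : Fin p × Fin m → R) (r : Fin p) (i : Fin m) :
    ((cyc p s ⊗ₖ (1 : Matrix (Fin m) (Fin m) R))ᵀ *ᵥ x) (r, i) =
      if (r : ℕ) = 0 then s * x (⟨p - 1, Nat.sub_lt r.pos one_pos⟩, i)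
      else x (⟨r - 1, by omega⟩, i) := by
  rw [← smul_eq_mul, ← sum_cyc_transpose_smul s r (fun k => x (k, i))]
  simp [mulVec, dotProduct, kroneckerMap_apply, Fintype.sum_prod_type, one_apply]

theorem cyc_kronecker_mul {t t' : R} (ht : t * t' = 1) :
    (cyc p t ⊗ₖ (1 : Matrix (Fin m) (Fin m) R)) * (cyc p t' ⊗ₖ 1)ᵀ = 1 := by
  rw [← kroneckerMap_transpose, ← mul_kronecker_mul, cyc_mul_transpose ht]
  simp

variable [Algebra ℝ R]

/-- The sign `±1` relating `D` to the determinant of the Floquet matrix. -/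
def cycSign (m p : ℕ) : ℝ := (cyc p (1 : ℝ)).det ^ m

theorem cycSign_ne_zero : cycSign m p ≠ 0 := by
  refine pow_ne_zero _ fun h => ?_
  have := congrArg det (cyc_mul_transpose (p := p) (mul_one (1 : ℝ)))
  simp [h] at this

/-- The block diagonal matrix with diagonal blocks `c 1, …, c p`. -/
def siteDiag (p : ℕ) (c : ℤ → Matrix (Fin m) (Fin m) ℝ) :
    Matrix (Fin p × Fin m) (Fin p × Fin m) R :=
  Matrix.of fun x y => if x.1 = y.1 then algebraMap ℝ R (c ((x.1 : ℕ) + 1) x.2 y.2) else 0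

/-- The Floquet matrix: the difference expression on sequences with `y_{n+p} = t y_n`, in the
coordinates `y_1, …, y_p`. The index `(r, i)` stands for the component `i` at the site `r + 1`, and
`t'` for `t⁻¹`. -/
def floquet (J : PeriodicJacobi m p) (t t' : R) : Matrix (Fin p × Fin m) (Fin p × Fin m) R :=
  siteDiag p J.a * (cyc p t ⊗ₖ 1) + siteDiag p J.b + (cyc p t' ⊗ₖ 1)ᵀ * (siteDiag p J.a)ᵀ

theorem siteDiag_mulVec (c : ℤ → Matrix (Fin m) (Fin m) ℝ) (x : Fin p × Fin m → R)
    (r : Fin p) (i : Fin m) : (siteDiag p c *ᵥ x) (r, i) =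
      ∑ j, algebraMap ℝ R (c ((r : ℕ) + 1) i j) * x (r, j) := by
  simp [mulVec, dotProduct, siteDiag, Fintype.sum_prod_type, ite_mul, Finset.sum_ite_irrel]

theorem siteDiag_transpose_mulVec (c : ℤ → Matrix (Fin m) (Fin m) ℝ) (x : Fin p × Fin m → R)
    (r : Fin p) (i : Fin m) : ((siteDiag p c)ᵀ *ᵥ x) (r, i) =
      ∑ j, algebraMap ℝ R (c ((r : ℕ) + 1) j i) * x (r, j) := by
  simp [mulVec, dotProduct, siteDiag, Fintype.sum_prod_type, ite_mul, Finset.sum_ite_irrel]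

theorem det_siteDiag (c : ℤ → Matrix (Fin m) (Fin m) ℝ) :
    (siteDiag p c : Matrix _ _ R).det = algebraMap ℝ R (∏ r : Fin p, (c ((r : ℕ) + 1)).det) := by
  have h : (siteDiag p c : Matrix _ _ R) =
      (blockDiagonal fun r : Fin p => (c ((r : ℕ) + 1)).map (algebraMap ℝ R)).submatrix
        (Equiv.prodComm _ _) (Equiv.prodComm _ _) := by
    ext ⟨r, i⟩ ⟨k, j⟩
    simp [siteDiag, blockDiagonal_apply]
  rw [h, det_submatrix_equiv_self, det_blockDiagonal, map_prod]
  refine Finset.prod_congr rfl fun r _ => ?_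
  rw [RingHom.map_det]; rfl

/-- The Floquet matrix in which the sites are shifted by one; for `s = 0` it is the matrix of the
initial value problem, which determines `y_2, …, y_{p+1}`. -/
def shifted (J : PeriodicJacobi m p) (z s : R) : Matrix (Fin p × Fin m) (Fin p × Fin m) R :=
  siteDiag p J.a + (siteDiag p J.b - z • 1) * (cyc p s ⊗ₖ 1)ᵀ +
    (cyc p s ⊗ₖ 1)ᵀ * (siteDiag p J.a)ᵀ * (cyc p s ⊗ₖ 1)ᵀ

theorem floquet_sub_smul_mul (J : PeriodicJacobi m p) (z : R) {t t' : R} (ht : t * t' = 1) :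
    (J.floquet t t' - z • 1) * (cyc p t' ⊗ₖ 1)ᵀ = J.shifted z t' := by
  rw [floquet, shifted]
  simp only [add_mul, sub_mul]
  rw [mul_assoc _ (cyc p t ⊗ₖ _), cyc_kronecker_mul ht, mul_one]
  abel

/-- The terms of the equations at the sites `1, …, p` that contain `y_0` and `y_1`. -/
def initialPart (J : PeriodicJacobi m p) (z : R) : Matrix (Fin p × Fin m) (Fin m ⊕ Fin m) R :=
  Matrix.of fun x y => Sum.elim
    (fun j => if (x.1 : ℕ) = 0 then algebraMap ℝ R (J.a 0 j x.2) else 0)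
    (fun j => if (x.1 : ℕ) = 0 then
        algebraMap ℝ R (J.b 1 x.2 j) - z * (1 : Matrix (Fin m) (Fin m) R) x.2 j
      else if (x.1 : ℕ) = 1 then algebraMap ℝ R (J.a 1 j x.2) else 0) y

/-- The matrix of the map `(y_2, …, y_{p+1}) ↦ (y_0, y_1)` for sequences with
`y_n = s y_{n+p}`. -/
def boundaryPart (m p : ℕ) [NeZero p] (s : R) :
    Matrix (Fin m ⊕ Fin m) (Fin p × Fin m) R :=
  Matrix.of fun x y => Sum.elim
    (fun i => s * (cyc p s ⊗ₖ (1 : Matrix (Fin m) (Fin m) R))ᵀ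
      (⟨p - 1, Nat.sub_lt (Nat.pos_of_ne_zero (NeZero.ne p)) one_pos⟩, i) y)
    (fun i => s * (1 : Matrix (Fin p × Fin m) (Fin p × Fin m) R)
      (⟨p - 1, Nat.sub_lt (Nat.pos_of_ne_zero (NeZero.ne p)) one_pos⟩, i) y) x

/-- The matrix of the map `(y_0, y_1) ↦ (y_2, …, y_{p+1})` given by the solutions. -/
def solutionPart (J : PeriodicJacobi m p) (z : R) : Matrix (Fin p × Fin m) (Fin m ⊕ Fin m) R :=
  Matrix.of fun x y => Sum.elim (fun j => J.theta z (x.1 + 2) x.2 j)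
    (fun j => J.phi z (x.1 + 2) x.2 j) y

theorem solution_recurrence (J : PeriodicJacobi m p) (z : R) (y₀ y₁ : Matrix (Fin m) (Fin m) R)
    (n : ℕ) : (J.a (n + 1)).map (algebraMap ℝ R) * J.solution z y₀ y₁ (n + 2) +
      ((J.b (n + 1)).map (algebraMap ℝ R) - z • 1) * J.solution z y₀ y₁ (n + 1) +
      (J.a n)ᵀ.map (algebraMap ℝ R) * J.solution z y₀ y₁ n = 0 := by
  have h : (J.a (n + 1)).map (algebraMap ℝ R) * (J.a (n + 1))⁻¹.map (algebraMap ℝ R) = 1 := by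
    rw [← Matrix.map_mul, mul_nonsing_inv _ (IsUnit.mk0 _ (J.a_det _))]
    simp
  rw [solution, ← mul_assoc, h, one_mul, sub_mul, sub_mul]
  abel

theorem solution_recurrence_apply (J : PeriodicJacobi m p) (z : R)
    (y₀ y₁ : Matrix (Fin m) (Fin m) R) (n : ℕ) (i j : Fin m) :
    ∑ k, algebraMap ℝ R (J.a (n + 1) i k) * J.solution z y₀ y₁ (n + 2) k j +
      (∑ k, algebraMap ℝ R (J.b (n + 1) i k) * J.solution z y₀ y₁ (n + 1) k j -
        z * J.solution z y₀ y₁ (n + 1) i j) +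
      ∑ k, algebraMap ℝ R (J.a n k i) * J.solution z y₀ y₁ n k j = 0 := by
  have h := congrFun (congrFun (J.solution_recurrence z y₀ y₁ n) i) j
  rw [sub_mul, smul_mul_assoc, one_mul] at h
  simpa [mul_apply] using h

theorem shifted_mulVec (J : PeriodicJacobi m p) (z s : R) (x : Fin p × Fin m → R) :
    J.shifted z s *ᵥ x = siteDiag p J.a *ᵥ x +
      (siteDiag p J.b *ᵥ ((cyc p s ⊗ₖ 1)ᵀ *ᵥ x) - z • ((cyc p s ⊗ₖ 1)ᵀ *ᵥ x)) +
      (cyc p s ⊗ₖ 1)ᵀ *ᵥ ((siteDiag p J.a)ᵀ *ᵥ ((cyc p s ⊗ₖ 1)ᵀ *ᵥ x)) := by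
  simp only [shifted, add_mulVec, sub_mulVec, ← mulVec_mulVec, smul_mulVec, one_mulVec]

/-- The dependence on `s` comes from the terms with `y_0` and `y_1` alone. -/
theorem shifted_eq [NeZero p] (J : PeriodicJacobi m p) (z s : R) :
    J.shifted z s = J.shifted z 0 + J.initialPart z * boundaryPart m p s := by
  refine Matrix.toLin'.injective (LinearMap.ext fun x => ?_)
  simp only [toLin'_apply, add_mulVec, ← mulVec_mulVec]
  have hl : ∀ j, (boundaryPart m p s *ᵥ x) (Sum.inl j) =
      s * ((cyc p s ⊗ₖ (1 : Matrix (Fin m) (Fin m) R))ᵀ *ᵥ x)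
      (⟨p - 1, Nat.sub_lt (Nat.pos_of_ne_zero (NeZero.ne p)) one_pos⟩, j) := fun j => by
    simp only [mulVec, dotProduct, boundaryPart, of_apply, Sum.elim_inl, Finset.mul_sum, mul_assoc]
  have hr : ∀ j, (boundaryPart m p s *ᵥ x) (Sum.inr j) =
      s * x (⟨p - 1, Nat.sub_lt (Nat.pos_of_ne_zero (NeZero.ne p)) one_pos⟩, j) := fun j => by
    simp [mulVec, dotProduct, boundaryPart, one_apply]
  have ha : J.a p = J.a 0 := by simpa using J.a_periodic 0
  have hi : ∀ r i, (J.initialPart z *ᵥ (boundaryPart m p s *ᵥ x)) (r, i) =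
      if (r : ℕ) = 0 then
        ∑ j, algebraMap ℝ R (J.a 0 j i) * (boundaryPart m p s *ᵥ x) (Sum.inl j) +
        (∑ j, algebraMap ℝ R (J.b 1 i j) * (boundaryPart m p s *ᵥ x) (Sum.inr j) -
          z * (boundaryPart m p s *ᵥ x) (Sum.inr i))
      else if (r : ℕ) = 1 then
        ∑ j, algebraMap ℝ R (J.a 1 j i) * (boundaryPart m p s *ᵥ x) (Sum.inr j) else 0 := by
    intro r i
    generalize boundaryPart m p s *ᵥ x = y
    simp only [mulVec, dotProduct, Fintype.sum_sum_type, initialPart, of_apply, Sum.elim_inl,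
      Sum.elim_inr]
    split_ifs with h1 h2
    · simp [one_apply, sub_mul, Finset.sum_sub_distrib]
    · simp
    · simp
  ext ⟨r, i⟩
  rw [Pi.add_apply, hi, shifted_mulVec, shifted_mulVec]
  simp only [hl, hr, Pi.add_apply, Pi.sub_apply, Pi.smul_apply, siteDiag_mulVec,
    cyc_kronecker_transpose_mulVec, siteDiag_transpose_mulVec, smul_eq_mul]
  by_cases h0 : (r : ℕ) = 0
  · have hp : ((p - 1 : ℕ) : ℤ) + 1 = p := by have := r.pos; omega
    simp only [h0, if_true, hp, ha, zero_mul, mul_zero, Finset.sum_const_zero, Nat.cast_zero,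
      zero_add, sub_zero, add_zero]
    simp only [Finset.mul_sum, mul_left_comm s]
    ring
  · by_cases h1 : (r : ℕ) = 1
    · simp [h1]
    · have : ¬ ((r : ℕ) - 1 = 0) := by omega
      simp [h0, h1, this]

/-- `ϑ` and `φ` solve the initial value problem. -/
theorem shifted_zero_mul_solutionPart (J : PeriodicJacobi m p) (z : R) :
    J.shifted z 0 * J.solutionPart z = - J.initialPart z := by
  ext ⟨r, i⟩ y
  have hmul : (J.shifted z 0 * J.solutionPart z) (r, i) y =
      (J.shifted z 0 *ᵥ fun x => J.solutionPart z x y) (r, i) := rfl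
  rw [hmul, shifted_mulVec]
  change _ = -(J.initialPart z (r, i) y)
  simp only [Pi.add_apply, Pi.sub_apply, Pi.smul_apply, siteDiag_mulVec,
    cyc_kronecker_transpose_mulVec, siteDiag_transpose_mulVec, smul_eq_mul]
  obtain ⟨y₀, y₁, j, hsol, h0, h1⟩ : ∃ (y₀ y₁ : Matrix (Fin m) (Fin m) R) (j : Fin m),
      (∀ x : Fin p × Fin m, J.solutionPart z x y = J.solution z y₀ y₁ (x.1 + 2) x.2 j) ∧
      (J.initialPart z (r, i) y = if (r : ℕ) = 0 then
          ∑ k, algebraMap ℝ R (J.a 0 k i) * y₀ k j + (∑ k, algebraMap ℝ R (J.b 1 i k) * y₁ k j -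
          z * y₁ i j)
        else if (r : ℕ) = 1 then ∑ k, algebraMap ℝ R (J.a 1 k i) * y₁ k j else 0) ∧ True := by
    rcases y with j | j
    · refine ⟨1, 0, j, fun x => rfl, ?_, trivial⟩
      simp [initialPart, one_apply]
    · refine ⟨0, 1, j, fun x => rfl, ?_, trivial⟩
      simp [initialPart, one_apply]
  simp only [hsol, h0]
  by_cases h0 : (r : ℕ) = 0
  · have h := J.solution_recurrence_apply z y₀ y₁ 0 i j
    simp only [h0, if_true, zero_mul, mul_zero, Finset.sum_const_zero, sub_zero, add_zero]
    simp only [solution, Nat.cast_zero, zero_add] at h ⊢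
    linear_combination h
  · by_cases h1 : (r : ℕ) = 1
    · have h := J.solution_recurrence_apply z y₀ y₁ 1 i j
      simp only [h1, if_true, zero_mul, mul_zero, Finset.sum_const_zero, add_zero,
        Nat.sub_self, one_ne_zero, if_false]
      simp only [Nat.cast_one, Nat.reduceAdd, zero_add, solution.eq_2] at h ⊢
      linear_combination h
    · obtain ⟨n, hn⟩ : ∃ n, (r : ℕ) = n + 2 := ⟨r - 2, by omega⟩
      have h := J.solution_recurrence_apply z y₀ y₁ (n + 2) i j
      simp only [hn, Nat.add_eq_zero_iff, OfNat.ofNat_ne_zero, and_false, if_false,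
        Nat.add_one_sub_one, Nat.reduceEqDiff, one_ne_zero, neg_zero] at h ⊢
      push_cast at h ⊢
      rw [show (n : ℤ) + 1 + 1 = n + 2 by ring]
      exact h

/-- For `s = 0` the matrix `shifted` is block triangular with the diagonal blocks `a 1, …, a p`. -/
theorem det_shifted_zero (J : PeriodicJacobi m p) (z : R) :
    (J.shifted z 0).det = algebraMap ℝ R (∏ r : Fin p, (J.a ((r : ℕ) + 1)).det) := by
  have hlow : ∀ {x y : Fin p × Fin m}, x.1 ≤ y.1 →
      J.shifted z 0 x y = (siteDiag p J.a : Matrix _ _ R) x y := by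
    rintro ⟨r, i⟩ ⟨k, j⟩ hrk
    have hx : (J.shifted z 0) (r, i) (k, j) =
      (J.shifted z 0 *ᵥ Pi.single (k, j) 1) (r, i) := by simp
    have hx' : (siteDiag p J.a : Matrix _ _ R) (r, i) (k, j) =
      (siteDiag p J.a *ᵥ Pi.single (k, j) 1) (r, i) := by simp
    rw [hx, hx', shifted_mulVec]
    simp only [Pi.add_apply, Pi.sub_apply, Pi.smul_apply, siteDiag_mulVec,
      cyc_kronecker_transpose_mulVec, siteDiag_transpose_mulVec, smul_eq_mul, zero_mul]
    have hz : ∀ (n : ℕ) (hn : n < p) (i' : Fin m), n < k →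
        (Pi.single (k, j) (1 : R) : Fin p × Fin m → R) (⟨n, hn⟩, i') = 0 := by
      intro n hn i' hnk
      refine Pi.single_eq_of_ne (fun h => ?_) _
      have := congrArg (fun x => (x.1 : ℕ)) h
      simp only at this
      omega
    have hrk' : (r : ℕ) ≤ k := hrk
    by_cases h0 : (r : ℕ) = 0
    · simp [h0]
    · have h1 : (r : ℕ) - 1 < k := by omega
      have h2 : (r : ℕ) - 1 - 1 < k := by omega
      simp [h0, hz _ _ _ h1, hz _ _ _ h2]
  rw [← det_siteDiag, ← det_transpose, ← det_transpose (siteDiag p J.a)]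
  have h1 : BlockTriangular (J.shifted z 0)ᵀ Prod.fst := by
    intro x y hxy
    rw [transpose_apply, hlow hxy.le]
    simp [siteDiag, hxy.ne]
  have h2 : BlockTriangular (siteDiag p J.a : Matrix _ _ R)ᵀ Prod.fst := by
    intro x y hxy
    simp [siteDiag, hxy.ne]
  rw [h1.det_fintype, h2.det_fintype]
  refine Finset.prod_congr rfl fun k _ => ?_
  congr 1
  ext ⟨x, hx⟩ ⟨y, hy⟩
  exact hlow (hy.trans hx.symm).le

theorem D_eq_det_monodromy (J : PeriodicJacobi m p) (z t : R) :
    J.D z t = (J.monodromy z - t • 1).det := by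
  have h : J.P₀.map (algebraMap ℝ R) * J.P₀⁻¹.map (algebraMap ℝ R) = 1 := by
    rw [← Matrix.map_mul, mul_nonsing_inv]
    · simp
    · refine IsUnit.mk0 _ ?_
      rw [P₀, det_fromBlocks_zero₂₁, det_one, mul_one]
      exact J.a_det 0
  have h2 : J.modMonodromy z - t • 1 = J.P₀.map (algebraMap ℝ R) * (J.monodromy z - t • 1) *
      J.P₀⁻¹.map (algebraMap ℝ R) := by
    rw [mul_sub, sub_mul, mul_smul_comm, mul_one, smul_mul_assoc, h, modMonodromy]
  rw [D, h2, det_mul, det_mul, mul_right_comm, ← det_mul, h, det_one, one_mul]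

/-- The product `boundaryPart * solutionPart` maps, for `p ≥ 2`, the initial values `(y_0, y_1)` of
a solution to `s (y_p, y_{p+1})`. For `p = 1` the site `p` is the site `1`, where the solution is
not part of `solutionPart`, and the Bloch condition is used a second time; the determinant is not
affected. -/
theorem det_one_sub [NeZero p] (J : PeriodicJacobi m p) (z s : R) :
    (1 - boundaryPart m p s * J.solutionPart z : Matrix (Fin m ⊕ Fin m) (Fin m ⊕ Fin m) R).det =
      (1 - s • J.monodromy z).det := by
  have hp := Nat.pos_of_ne_zero (NeZero.ne p)
  have hl : ∀ i y, (boundaryPart m p s * J.solutionPart z) (Sum.inl i) y =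
      s * if p = 1 then s * J.solutionPart z (⟨p - 1, Nat.sub_lt hp one_pos⟩, i) y
      else J.solutionPart z (⟨p - 1 - 1, by omega⟩, i) y := fun i y => by
    have h := cyc_kronecker_transpose_mulVec s (fun x : Fin p × Fin m => J.solutionPart z x y)
      ⟨p - 1, Nat.sub_lt hp one_pos⟩ i
    have h1 : p - 1 = 0 ↔ p = 1 := by omega
    simp only [h1] at h
    rw [← h]
    simp only [mul_apply, mulVec, dotProduct, boundaryPart, of_apply, Sum.elim_inl, Finset.mul_sum,
      mul_assoc]
  have hr : ∀ i y, (boundaryPart m p s * J.solutionPart z) (Sum.inr i) y =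
      s * J.solutionPart z (⟨p - 1, Nat.sub_lt hp one_pos⟩, i) y := fun i y => by
    simp [mul_apply, boundaryPart, one_apply]
  by_cases h1 : p = 1
  · subst h1
    have h2 : (1 - boundaryPart m 1 s * J.solutionPart z :
        Matrix (Fin m ⊕ Fin m) (Fin m ⊕ Fin m) R) =
        fromBlocks 1 (s • 1) 0 1 * (1 - s • J.monodromy z) := by
      have h3 : (1 - s • J.monodromy z) =
          fromBlocks 1 (-(s • 1)) (-(s • J.theta z 2)) (1 - s • J.phi z 2) := by
        rw [monodromy, ← fromBlocks_one, fromBlocks_smul, sub_eq_add_neg, fromBlocks_neg,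
          fromBlocks_add]
        simp [theta, phi, solution.eq_2, sub_eq_add_neg]
      rw [h3, fromBlocks_multiply]
      ext (i | i) (j | j)
      · rw [Matrix.sub_apply, hl]; simp [solutionPart, sub_eq_add_neg, one_apply]
      · rw [Matrix.sub_apply, hl]; simp [solutionPart, mul_sub, one_apply]; ring
      · rw [Matrix.sub_apply, hr]; simp [solutionPart]
      · rw [Matrix.sub_apply, hr]; simp [solutionPart, one_apply]
    rw [h2, det_mul, det_fromBlocks_zero₂₁]
    simp
  · congr 2
    have e1 : p - 1 - 1 + 2 = p := by omega
    have e2 : p - 1 + 2 = p + 1 := by omega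
    ext (i | i) (j | j)
    · rw [hl, if_neg h1]; simp [solutionPart, monodromy, e1]
    · rw [hl, if_neg h1]; simp [solutionPart, monodromy, e1]
    · rw [hr]; simp [solutionPart, monodromy, e2]
    · rw [hr]; simp [solutionPart, monodromy, e2]

/-- `D(z, t)` is, up to a factor independent of `z`, the determinant of the Floquet matrix
minus `z`. -/
theorem det_floquet_sub [NeZero p] (J : PeriodicJacobi m p) (z : R) {t t' : R} (ht : t * t' = 1) :
    (J.floquet t t' - z • 1).det = algebraMap ℝ R (cycSign m p *
      ∏ r : Fin p, (J.a ((r : ℕ) + 1)).det) * t' ^ m * J.D z t := by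
  have h1 : J.floquet t t' - z • 1 = J.shifted z t' * (cyc p t ⊗ₖ 1) := by
    rw [← J.floquet_sub_smul_mul z ht, mul_assoc, mul_eq_one_comm.1 (cyc_kronecker_mul ht), mul_one]
  have h2 : J.shifted z t' = J.shifted z 0 * (1 - J.solutionPart z * boundaryPart m p t') := by
    rw [mul_sub, mul_one, ← Matrix.mul_assoc, shifted_zero_mul_solutionPart, shifted_eq]
    simp
  have h3 : (1 - t' • J.monodromy z).det = t' ^ m * t' ^ m * J.D z t := by
    have : 1 - t' • J.monodromy z = (-t') • (J.monodromy z - t • 1) := by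
      rw [neg_smul, smul_sub, smul_smul, mul_comm t' t, ht, one_smul, neg_sub]
    rw [this, det_smul, D_eq_det_monodromy]
    simp only [Fintype.card_sum, Fintype.card_fin, pow_add, ← mul_pow]
    simp
  have h4 : (cyc p (1 : R)).det = algebraMap ℝ R (cyc p (1 : ℝ)).det := by
    rw [RingHom.map_det, RingHom.mapMatrix_apply, cyc_map, map_one]
  have h5 : t' ^ m * t ^ m = 1 := by rw [← mul_pow, mul_comm, ht, one_pow]
  rw [h1, h2, det_mul, det_mul, det_one_sub_mul_comm, det_one_sub, h3, det_shifted_zero,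
    det_kronecker, det_one, one_pow, mul_one, det_cyc, Fintype.card_fin, h4, cycSign, map_mul,
    map_pow, mul_pow]
  linear_combination (algebraMap ℝ R (∏ r : Fin p, (J.a ((r : ℕ) + 1)).det) * t' ^ m * J.D z t *
    algebraMap ℝ R (cyc p (1 : ℝ)).det ^ m) * h5

end

end PeriodicJacobi

/-! ### Polynomials with bounds on the degrees of the coefficients -/

namespace PeriodicJacobi

noncomputable section

open Matrix Polynomial

/-- If a polynomial of degree `2m` is palindromic, then it is `t ^ m` times a polynomial in
`t + t⁻¹`. A filtration of the coefficients, counted from the top one, is inherited. -/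
theorem exists_of_palindromic {R : Type*} [CommRing R] (m : ℕ) :
    ∀ (F : ℕ → AddSubgroup R), Monotone F → ∀ P : R[X], (∀ k, 2 * m < k → P.coeff k = 0) →
      (∀ k ≤ 2 * m, P.coeff k = P.coeff (2 * m - k)) →
      (∀ k ≤ m, P.coeff (2 * m - k) ∈ F k) →
      ∃ Φ : R[X], (∀ k, m < k → Φ.coeff k = 0) ∧ (∀ k ≤ m, Φ.coeff (m - k) ∈ F k) ∧
        Φ.coeff m = P.coeff (2 * m) ∧
        ∀ t t' : R, t * t' = 1 → P.eval t = t ^ m * Φ.eval (t + t') := by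
  induction m with
  | zero =>
    intro F _ P h0 _ hF
    have hP : P = C (P.coeff 0) := by
      ext (_ | k)
      · simp
      · rw [h0 _ (by omega), coeff_C_succ]
    refine ⟨P, by simpa using h0, fun k hk => ?_, by simp, fun t t' _ => ?_⟩
    · simpa using hF k hk
    · rw [hP]; simp
  | succ m ih =>
    intro F hmono P h0 hpal hF
    set c := P.coeff (2 * (m + 1)) with hc
    set Q : R[X] := (X ^ 2 + 1) ^ (m + 1) with hQ
    have hQe : Q = expand R 2 ((X + 1) ^ (m + 1)) := by simp [hQ]
    have hQc : ∀ k, Q.coeff k = if 2 ∣ k then ((m + 1).choose (k / 2) : R) else 0 := fun k => by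
      rw [hQe, coeff_expand two_pos, coeff_X_add_one_pow]
    have hc0 : c ∈ F 0 := by simpa using hF 0 (Nat.zero_le _)
    have hQ1 : Q.coeff (2 * (m + 1)) = 1 := by rw [hQc]; simp
    have hQpal : ∀ k ≤ 2 * (m + 1), Q.coeff k = Q.coeff (2 * (m + 1) - k) := fun k hk => by
      rw [hQc, hQc]
      have : 2 ∣ k ↔ 2 ∣ 2 * (m + 1) - k := by omega
      by_cases h : 2 ∣ k
      · rw [if_pos h, if_pos (this.1 h)]
        have : (2 * (m + 1) - k) / 2 = (m + 1) - k / 2 := by omega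
        rw [this, Nat.choose_symm (by omega)]
      · rw [if_neg h, if_neg (fun h' => h (this.2 h'))]
    set P₁ : R[X] := divX (P - C c * Q) with hP₁
    have hcoeff : ∀ k, P₁.coeff k = P.coeff (k + 1) - c * Q.coeff (k + 1) := fun k => by
      rw [hP₁, coeff_divX, coeff_sub, coeff_C_mul]
    have hQ2 : ∀ k, 2 * (m + 1) < k → Q.coeff k = 0 := fun k hk => by
      rw [hQc]
      split_ifs with h
      · rw [Nat.choose_eq_zero_of_lt (by omega), Nat.cast_zero]
      · rfl
    have hPQ : P = C c * Q + X * P₁ := by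
      have h := divX_mul_X_add (P - C c * Q)
      have h1 : (P - C c * Q).coeff 0 = 0 := by
        rw [coeff_sub, coeff_C_mul, hpal 0 (by omega), hQpal 0 (by omega)]
        simp [hQ1, ← hc]
      rw [h1, C_0, add_zero, ← hP₁] at h
      linear_combination -h
    have h1 : ∀ k, 2 * m < k → P₁.coeff k = 0 := by
      intro k hk
      rw [hcoeff]
      rcases (show k + 1 = 2 * (m + 1) ∨ 2 * (m + 1) < k + 1 by omega) with h | h
      · rw [h, hQ1, ← hc]; ring
      · rw [h0 _ h, hQ2 _ h]; ring
    have h2 : ∀ k ≤ 2 * m, P₁.coeff k = P₁.coeff (2 * m - k) := by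
      intro k hk
      rw [hcoeff, hcoeff, hpal _ (by omega), hQpal _ (by omega)]
      congr 2 <;> [skip; congr 1] <;> omega
    have h3 : ∀ k ≤ m, P₁.coeff (2 * m - k) ∈ F (k + 1) := by
      intro k hk
      rw [hcoeff, show 2 * m - k + 1 = 2 * (m + 1) - (k + 1) by omega]
      refine sub_mem (hF _ (by omega)) ?_
      rw [hQc]
      split_ifs
      · rw [mul_comm, ← nsmul_eq_mul]
        exact nsmul_mem (hmono (Nat.zero_le _) hc0) _
      · simp
    obtain ⟨Φ, hΦ0, hΦF, -, hΦ⟩ := ih (fun k => F (k + 1)) (fun a b hab => hmono (by omega)) P₁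
      h1 h2 h3
    refine ⟨C c * X ^ (m + 1) + Φ, fun k hk => ?_, fun k hk => ?_, ?_, fun t t' ht => ?_⟩
    · rw [coeff_add, coeff_C_mul, coeff_X_pow, hΦ0 _ (by omega), if_neg (by omega)]; simp
    · rw [coeff_add, coeff_C_mul, coeff_X_pow]
      rcases k with _ | k
      · simpa [hΦ0 (m + 1) (by omega)] using hc0
      · rw [if_neg (by omega), mul_zero, zero_add, Nat.add_sub_add_right]
        exact hΦF k (by omega)
    · rw [coeff_add, coeff_C_mul, coeff_X_pow, hΦ0 _ (by omega)]; simp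
    · rw [hPQ]
      simp only [eval_add, eval_mul, eval_C, eval_X, eval_pow, hΦ t t' ht, hQ, eval_one]
      have : t ^ 2 + 1 = t * (t + t') := by rw [mul_add, ht, sq]
      rw [this, mul_pow]
      ring

/-- The interpolation argument: a polynomial in two variables, of degree at most `jp` in the first
variable in its coefficient of `Y ^ (m - j)`, vanishes if for each of `m + 1` values `ν_j` of `Y`
it has a factor of degree `(m - j)p + 1`. -/
theorem eq_zero_of_dvd_eval {K : Type*} [Field K] (p m : ℕ) :
    ∀ (ν : ℕ → K) (q : ℕ → K[X]) (P : K[X][X]), Set.InjOn ν (Set.Iic m) →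
      (∀ j ≤ m, (q j).degree = ((m - j) * p + 1 : ℕ)) → (∀ k, m < k → P.coeff k = 0) →
      (∀ j ≤ m, (P.coeff (m - j)).degree ≤ (j * p : ℕ)) →
      (∀ j ≤ m, q j ∣ P.eval (C (ν j))) → P = 0 := by
  induction m with
  | zero =>
    intro ν q P _ hq h0 hdeg hdvd
    have hP : P = C (P.coeff 0) := by
      ext1 (_ | k)
      · simp
      · rw [h0 _ (by omega), coeff_C_succ]
    have h := hdvd 0 le_rfl
    rw [hP, eval_C] at h
    rw [hP, eq_zero_of_dvd_of_degree_lt h, C_0]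
    rw [hq 0 le_rfl]
    refine (hdeg 0 le_rfl).trans_lt ?_
    exact_mod_cast Nat.lt_succ_self _
  | succ m ih =>
    intro ν q P hν hq h0 hdeg hdvd
    have hroot : P.eval (C (ν 0)) = 0 := by
      refine eq_zero_of_dvd_of_degree_lt (hdvd 0 (Nat.zero_le _)) ?_
      rw [hq 0 (Nat.zero_le _)]
      have hle : (P.eval (C (ν 0))).degree ≤ ((m + 1) * p : ℕ) := by
        rw [eval_eq_sum_range' (n := m + 2)]
        · refine (degree_sum_le _ _).trans (Finset.sup_le fun k hk => ?_)
          have hk' : k ≤ m + 1 := by simpa [Nat.lt_succ_iff] using hk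
          have h1 := hdeg (m + 1 - k) (by omega)
          rw [Nat.sub_sub_self hk'] at h1
          rw [← C_pow, mul_comm]
          rw [C_mul']
          refine (degree_smul_le _ _).trans (h1.trans ?_)
          exact_mod_cast Nat.mul_le_mul_right _ (Nat.sub_le _ _)
        · rw [Nat.lt_succ_iff, natDegree_le_iff_coeff_eq_zero]
          exact h0
      refine hle.trans_lt ?_
      exact_mod_cast Nat.lt_succ_self _
    obtain ⟨Q, rfl⟩ := dvd_iff_isRoot.2 hroot
    have hcoeff : ∀ k, Q.coeff k =
        ((X - C (C (ν 0))) * Q).coeff (k + 1) + C (ν 0) * Q.coeff (k + 1) := fun k => by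
      rw [sub_mul, coeff_sub, coeff_X_mul, coeff_C_mul]; ring
    have hQ0 : ∀ k, m < k → Q.coeff k = 0 := by
      have hn : Q = 0 ∨ Q.natDegree ≤ m := by
        by_cases hQ : Q = 0
        · exact Or.inl hQ
        · right
          have h1 : ((X - C (C (ν 0))) * Q).natDegree ≤ m + 1 :=
            natDegree_le_iff_coeff_eq_zero.2 h0
          rw [natDegree_mul (X_sub_C_ne_zero _) hQ, natDegree_X_sub_C] at h1
          omega
      rcases hn with rfl | hn
      · simp
      · exact natDegree_le_iff_coeff_eq_zero.1 hn
    have hQdeg : ∀ j ≤ m, (Q.coeff (m - j)).degree ≤ (j * p : ℕ) := by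
      intro j
      induction j with
      | zero =>
        intro _
        rw [hcoeff, hQ0 (m - 0 + 1) (by omega), mul_zero, add_zero]
        exact hdeg 0 (Nat.zero_le _)
      | succ j ihj =>
        intro hj
        rw [hcoeff, show m - (j + 1) + 1 = m - j by omega]
        refine (degree_add_le _ _).trans (max_le ?_ ?_)
        · have := hdeg (j + 1) (by omega)
          rwa [Nat.add_sub_add_right] at this
        · rw [C_mul']
          refine (degree_smul_le _ _).trans ((ihj (by omega)).trans ?_)
          exact_mod_cast Nat.mul_le_mul_right _ (Nat.le_succ _)
    rw [ih (fun j => ν (j + 1)) (fun j => q (j + 1)) Q ?_ ?_ hQ0 hQdeg ?_, mul_zero]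
    · intro a ha b hb hab
      have := hν (x₁ := a + 1) (x₂ := b + 1) (by simpa using ha) (by simpa using hb) hab
      omega
    · intro j hj
      rw [hq (j + 1) (by omega), Nat.add_sub_add_right]
    · intro j hj
      have h := hdvd (j + 1) (by omega)
      rw [eval_mul, eval_sub, eval_X, eval_C, ← C_sub] at h
      have hne : ν (j + 1) - ν 0 ≠ 0 := sub_ne_zero.2 fun h' => by
        have := hν (x₁ := j + 1) (x₂ := 0) (by simpa using hj) (by simp) h'
        omega
      have hu : IsUnit (C (ν (j + 1) - ν 0)) := isUnit_C.2 (IsUnit.mk0 _ hne)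
      exact hu.dvd_mul_left.1 h

/-- A polynomial in two variables has weighted degree at most `d`, where the outer variable has
weight `q` and the inner one has weight `1`. -/
def WeightedDegreeLE {R : Type*} [CommRing R] (q d : ℕ) (P : R[X][X]) : Prop :=
  ∀ k l, d < l + k * q → (P.coeff k).coeff l = 0

namespace WeightedDegreeLE

variable {R : Type*} [CommRing R] {q : ℕ}

theorem mul {d e : ℕ} {P Q : R[X][X]} (hP : WeightedDegreeLE q d P)
    (hQ : WeightedDegreeLE q e Q) : WeightedDegreeLE q (d + e) (P * Q) := by
  intro k l hkl
  rw [coeff_mul, finsetSum_coeff]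
  refine Finset.sum_eq_zero fun x hx => ?_
  rw [coeff_mul]
  refine Finset.sum_eq_zero fun y hy => ?_
  rw [Finset.HasAntidiagonal.mem_antidiagonal] at hx hy
  rw [← hx, ← hy, add_mul] at hkl
  by_cases h : d < y.1 + x.1 * q
  · rw [hP _ _ h, zero_mul]
  · rw [hQ _ _ (by omega), mul_zero]

theorem prod {ι : Type*} (s : Finset ι) {d : ℕ} {P : ι → R[X][X]}
    (hP : ∀ i ∈ s, WeightedDegreeLE q d (P i)) :
    WeightedDegreeLE q (s.card * d) (∏ i ∈ s, P i) := by
  classical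
  induction s using Finset.induction_on with
  | empty =>
    intro k l hkl
    rcases k with _ | k
    · have hl : l ≠ 0 := by simp at hkl; omega
      simp [coeff_one, hl]
    · simp [coeff_one]
  | insert a s ha ih =>
    rw [Finset.prod_insert ha, Finset.card_insert_of_notMem ha, add_mul, one_mul, add_comm]
    exact (hP a (Finset.mem_insert_self _ _)).mul
      (ih fun i hi => hP i (Finset.mem_insert_of_mem hi))

theorem det {n : Type*} [Fintype n] [DecidableEq n] {d : ℕ} {M : Matrix n n R[X][X]}
    (hM : ∀ i j, WeightedDegreeLE q d (M i j)) :
    WeightedDegreeLE q (Fintype.card n * d) M.det := by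
  intro k l hkl
  rw [det_apply, finsetSum_coeff, finsetSum_coeff]
  refine Finset.sum_eq_zero fun σ _ => ?_
  have h := prod (Finset.univ : Finset n) (fun i _ => hM (σ i) i) k l hkl
  rcases Int.units_eq_one_or (Equiv.Perm.sign σ) with hs | hs <;> simp [hs, h]

theorem charpoly {n : Type*} [Fintype n] [DecidableEq n] {M : Matrix n n R[X]}
    (hM : ∀ i j, (M i j).natDegree ≤ q) :
    WeightedDegreeLE q (Fintype.card n * q) M.charpoly := by
  refine det fun i j k l hkl => ?_
  rw [charmatrix_apply]
  rcases k with _ | k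
  · have : (M i j).coeff l = 0 := coeff_eq_zero_of_natDegree_lt ((hM i j).trans_lt (by omega))
    by_cases hij : i = j
    · subst hij; simp [this]
    · simp [this, hij]
  · rcases k with _ | k
    · by_cases hij : i = j
      · subst hij
        have : l ≠ 0 := by omega
        simp [coeff_one, this]
      · simp [hij]
    · by_cases hij : i = j
      · subst hij; simp [coeff_X]
      · simp [hij]

end WeightedDegreeLE

end

end PeriodicJacobi

/-! ### The determinant as a polynomial -/

namespace PeriodicJacobi

noncomputable section

open Matrix Polynomial

variable {m p : ℕ}

theorem D_eq_eval_charpoly {R : Type*} [CommRing R] [Algebra ℝ R] (J : PeriodicJacobi m p)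
    (z t : R) : J.D z t = (J.monodromy z).charpoly.eval t := by
  rw [D_eq_det_monodromy, eval_charpoly, ← neg_sub, det_neg, scalar_apply, smul_one_eq_diagonal]
  simp [← two_mul]

theorem D_eq_eval_charpoly_modMonodromy {R : Type*} [CommRing R] [Algebra ℝ R]
    (J : PeriodicJacobi m p) (z t : R) : J.D z t = (J.modMonodromy z).charpoly.eval t := by
  rw [D, eval_charpoly, ← neg_sub, det_neg, scalar_apply, smul_one_eq_diagonal]
  simp [← two_mul]

theorem cyc_kronecker_map {R S : Type*} [CommRing R] [CommRing S] (f : R →+* S) (t : R) :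
    ((kroneckerMap (· * ·) (cyc p t) (1 : Matrix (Fin m) (Fin m) R)).map f) =
      kroneckerMap (· * ·) (cyc p (f t)) 1 := by
  rw [← cyc_map]
  ext ⟨r, i⟩ ⟨k, j⟩
  simp [kroneckerMap_apply, one_apply, apply_ite f]

theorem siteDiag_map {R S : Type*} [CommRing R] [Algebra ℝ R] [CommRing S] [Algebra ℝ S]
    (f : R →ₐ[ℝ] S) (c : ℤ → Matrix (Fin m) (Fin m) ℝ) :
    (siteDiag p c : Matrix _ _ R).map f = siteDiag p c := by
  ext x y
  simp [siteDiag, apply_ite f]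

theorem floquet_map {R S : Type*} [CommRing R] [Algebra ℝ R] [CommRing S] [Algebra ℝ S]
    (f : R →ₐ[ℝ] S) (J : PeriodicJacobi m p) (t t' : R) :
    (J.floquet t t').map f = J.floquet (f t) (f t') := by
  have h := cyc_kronecker_map (m := m) (p := p) (f : R →+* S)
  simp only [RingHom.coe_coe] at h
  simp only [floquet]
  rw [Matrix.map_add _ (map_add f), Matrix.map_add _ (map_add f), Matrix.map_mul, Matrix.map_mul,
    transpose_map, transpose_map, h, h, siteDiag_map, siteDiag_map]

theorem floquet_transpose {R : Type*} [CommRing R] [Algebra ℝ R] (J : PeriodicJacobi m p)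
    (t t' : R) : (J.floquet t t')ᵀ = J.floquet t' t := by
  have hb : (siteDiag p J.b : Matrix _ _ R)ᵀ = siteDiag p J.b := by
    ext ⟨r, i⟩ ⟨k, j⟩
    by_cases h : r = k
    · subst h
      have := congrFun (congrFun (J.b_symm ((r : ℕ) + 1)) i) j
      rw [transpose_apply] at this
      simp [siteDiag, this]
    · simp [siteDiag, h, Ne.symm h]
  simp only [floquet]
  rw [transpose_add, transpose_add, transpose_mul, transpose_mul, transpose_transpose,
    transpose_transpose, hb]
  abel

/-- The constant by which the characteristic polynomial of the Floquet matrix has to be multiplied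
to obtain `D`, apart from the power of `τ`. -/
def detConst (J : PeriodicJacobi m p) : ℝ :=
  (-1) ^ (p * m) * (cycSign m p * ∏ r : Fin p, (J.a ((r : ℕ) + 1)).det)⁻¹

theorem detConst_ne_zero (J : PeriodicJacobi m p) : J.detConst ≠ 0 :=
  mul_ne_zero (pow_ne_zero _ (by norm_num)) (inv_ne_zero (mul_ne_zero cycSign_ne_zero
    (Finset.prod_ne_zero_iff.2 fun _ _ => J.a_det _)))

theorem D_eq_det_floquet [NeZero p] {R : Type*} [CommRing R] [Algebra ℝ R]
    (J : PeriodicJacobi m p) (z : R) {t t' : R} (ht : t * t' = 1) :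
    J.D z t = algebraMap ℝ R J.detConst * t ^ m * (z • 1 - J.floquet t t').det := by
  set κ := cycSign m p * ∏ r : Fin p, (J.a ((r : ℕ) + 1)).det with hκ
  have hκ0 : κ ≠ 0 := mul_ne_zero cycSign_ne_zero (Finset.prod_ne_zero_iff.2 fun _ _ => J.a_det _)
  rw [← neg_sub, det_neg, det_floquet_sub J z ht, ← hκ, detConst, ← hκ, map_mul, map_pow, map_neg,
    map_one]
  simp only [Fintype.card_prod, Fintype.card_fin]
  have h1 : algebraMap ℝ R κ⁻¹ * algebraMap ℝ R κ = 1 := by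
    rw [← map_mul, inv_mul_cancel₀ hκ0, map_one]
  have h2 : t ^ m * t' ^ m = 1 := by rw [← mul_pow, ht, one_pow]
  have h3 : ((-1 : R) ^ (p * m)) * (-1) ^ (p * m) = 1 := by rw [← mul_pow]; simp
  calc J.D z t = ((-1 : R) ^ (p * m) * (-1) ^ (p * m)) *
      (algebraMap ℝ R κ⁻¹ * algebraMap ℝ R κ) * (t ^ m * t' ^ m) * J.D z t := by
        rw [h1, h2, h3]; ring
    _ = _ := by ring

theorem D_X_eq_charpoly [NeZero p] (J : PeriodicJacobi m p) {τ : ℂ} (hτ : τ ≠ 0) :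
    J.D (X : ℂ[X]) (C τ) = C (J.detConst * τ ^ m) * (J.floquet τ τ⁻¹).charpoly := by
  have h : (C τ : ℂ[X]) * C τ⁻¹ = 1 := by rw [← C_mul, mul_inv_cancel₀ hτ, C_1]
  rw [D_eq_det_floquet J _ h, Matrix.charpoly, charmatrix]
  have h2 : J.floquet (C τ : ℂ[X]) (C τ⁻¹) = (C : ℂ →+* ℂ[X]).mapMatrix (J.floquet τ τ⁻¹) :=
    (J.floquet_map ((CAlgHom : ℂ →ₐ[ℂ] ℂ[X]).restrictScalars ℝ) τ τ⁻¹).symm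
  rw [h2, C_mul, C_pow, scalar_apply, smul_one_eq_diagonal]
  rfl

theorem zeros_eq [NeZero p] (J : PeriodicJacobi m p) {τ : ℂ} (hτ : τ ≠ 0) :
    J.zeros τ = (J.floquet τ τ⁻¹).charpoly.roots := by
  rw [zeros, D_X_eq_charpoly J hτ, roots_C_mul]
  exact mul_ne_zero (Complex.ofReal_ne_zero.2 J.detConst_ne_zero) (pow_ne_zero _ hτ)

/-- The symmetry `D(z, t) = t ^ {2m} D(z, t⁻¹)`: transposition of the Floquet matrix interchanges
`t` and `t⁻¹`. -/
theorem D_inv [NeZero p] (J : PeriodicJacobi m p) {R : Type*} [CommRing R] [Algebra ℝ R] (z : R)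
    {t t' : R} (ht : t * t' = 1) : J.D z t = J.D z t' * t ^ (2 * m) := by
  rw [D_eq_det_floquet J z ht, D_eq_det_floquet J z ((mul_comm _ _).trans ht),
    ← det_transpose (z • 1 - J.floquet t t'), transpose_sub, floquet_transpose, transpose_smul,
    transpose_one]
  have h2 : t ^ m * t' ^ m = 1 := by rw [← mul_pow, ht, one_pow]
  rw [two_mul, pow_add]
  linear_combination (-algebraMap ℝ R J.detConst * (z • 1 - J.floquet t' t).det * t ^ m) * h2

theorem natDegree_solution_le (J : PeriodicJacobi m p) {y₀ y₁ : Matrix (Fin m) (Fin m) ℂ[X]}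
    (h₀ : ∀ i j, (y₀ i j).natDegree ≤ 0) (h₁ : ∀ i j, (y₁ i j).natDegree ≤ 0) (n : ℕ) :
    ∀ i j, (J.solution (X : ℂ[X]) y₀ y₁ n i j).natDegree ≤ n - 1 := by
  have hA : ∀ (A : Matrix (Fin m) (Fin m) ℝ) (B : Matrix (Fin m) (Fin m) ℂ[X]) (d : ℕ),
      (∀ i j, (B i j).natDegree ≤ d) →
      ∀ i j, ((A.map (algebraMap ℝ ℂ[X]) * B) i j).natDegree ≤ d := fun A B d hB i j => by
    rw [mul_apply]
    refine natDegree_sum_le_of_forall_le _ _ fun k _ => ?_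
    refine natDegree_mul_le.trans ?_
    have : (A.map (algebraMap ℝ ℂ[X]) i k).natDegree = 0 := natDegree_C _
    rw [this, zero_add]
    exact hB k j
  induction n using Nat.twoStepInduction with
  | zero => exact h₀
  | one => exact h₁
  | more n ih₀ ih₁ =>
    refine hA _ _ _ fun i j => ?_
    rw [Matrix.sub_apply, sub_mul, Matrix.sub_apply, smul_mul_assoc, one_mul, Matrix.smul_apply,
      smul_eq_mul]
    refine (natDegree_sub_le _ _).trans (max_le ((natDegree_sub_le _ _).trans (max_le ?_ ?_)) ?_)
    · refine natDegree_mul_le.trans ?_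
      rw [natDegree_X]
      have := ih₁ i j
      omega
    · exact (hA _ _ _ ih₁ i j).trans (by omega)
    · exact (hA _ _ _ ih₀ i j).trans (by omega)

theorem natDegree_monodromy_le (J : PeriodicJacobi m p) (x y : Fin m ⊕ Fin m) :
    (J.monodromy (X : ℂ[X]) x y).natDegree ≤ p := by
  have h1 : ∀ i j : Fin m, ((1 : Matrix (Fin m) (Fin m) ℂ[X]) i j).natDegree ≤ 0 := fun i j => by
    rw [one_apply]; split_ifs <;> simp
  have h0 : ∀ i j : Fin m, ((0 : Matrix (Fin m) (Fin m) ℂ[X]) i j).natDegree ≤ 0 := fun i j => by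
    simp
  rcases x with i | i <;> rcases y with j | j
  · exact (J.natDegree_solution_le h1 h0 p i j).trans (Nat.sub_le _ _)
  · exact (J.natDegree_solution_le h0 h1 p i j).trans (Nat.sub_le _ _)
  · exact J.natDegree_solution_le h1 h0 (p + 1) i j
  · exact J.natDegree_solution_le h0 h1 (p + 1) i j

/-- `D(z, t) = t ^ m Φ(z, t + t⁻¹)`, where `Φ` is monic of degree `m` in the second variable and
the coefficient of the `(m - j)`-th power has degree at most `jp` in `z`. -/
theorem exists_reduced [NeZero p] (J : PeriodicJacobi m p) : ∃ Φ : ℂ[X][X],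
    (∀ k, m < k → Φ.coeff k = 0) ∧
    (∀ k ≤ m, (Φ.coeff (m - k)).degree ≤ (k * p : ℕ)) ∧ Φ.coeff m = 1 ∧
    ∀ τ : ℂ, τ ≠ 0 → J.D (X : ℂ[X]) (C τ) = C τ ^ m * Φ.eval (C (τ + τ⁻¹)) := by
  set P := (J.monodromy (X : ℂ[X])).charpoly with hP
  have hdeg : P.natDegree = 2 * m := by
    rw [hP, charpoly_natDegree_eq_dim, Fintype.card_sum, Fintype.card_fin, two_mul]
  have hrefl : P.reflect (2 * m) = P := by
    refine eq_of_infinite_eval_eq _ _ ?_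
    have h1 : ((C : ℂ → ℂ[X]) '' {0}ᶜ).Infinite :=
      ((Set.finite_singleton (0 : ℂ)).infinite_compl).image C_injective.injOn
    refine h1.mono ?_
    rintro _ ⟨τ, hτ, rfl⟩
    have hτ : τ ≠ 0 := hτ
    have h : (C τ⁻¹ : ℂ[X]) * C τ = 1 := by rw [← C_mul, inv_mul_cancel₀ hτ, C_1]
    let _ : Invertible (C τ⁻¹ : ℂ[X]) := ⟨C τ, by rw [mul_comm, h], h⟩
    have h2 := eval₂_reflect_mul_pow (RingHom.id ℂ[X]) (C τ⁻¹ : ℂ[X]) (2 * m) P hdeg.le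
    have h3 : ⅟(C τ⁻¹ : ℂ[X]) = C τ := rfl
    rw [h3, ← Polynomial.eval, ← Polynomial.eval, hP, ← D_eq_eval_charpoly, J.D_inv X h] at h2
    rw [Set.mem_ofPred_eq]
    have h4 : (C τ⁻¹ : ℂ[X]) ^ (2 * m) ≠ 0 :=
      pow_ne_zero _ (C_ne_zero.2 (inv_ne_zero hτ))
    rw [← D_eq_eval_charpoly]
    exact mul_right_cancel₀ h4 h2
  have hw : WeightedDegreeLE p (2 * m * p) P := by
    have := WeightedDegreeLE.charpoly J.natDegree_monodromy_le
    rwa [Fintype.card_sum, Fintype.card_fin, ← two_mul] at this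
  obtain ⟨Φ, h1, h2, h3, h4⟩ := exists_of_palindromic m
    (fun k => (degreeLE ℂ ((k * p : ℕ) : WithBot ℕ)).toAddSubgroup)
    (fun a b hab => degreeLE_mono (by exact_mod_cast Nat.mul_le_mul_right _ hab)) P
    (fun k hk => coeff_eq_zero_of_natDegree_lt (by omega))
    (fun k hk => by
      conv_lhs => rw [← hrefl, coeff_reflect, revAt_le hk])
    (fun k hk => by
      change _ ∈ degreeLE ℂ _
      rw [mem_degreeLE, degree_le_iff_coeff_zero]
      intro l hl
      refine hw _ _ ?_
      have hl : k * p < l := by exact_mod_cast hl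
      calc 2 * m * p = (k + (2 * m - k)) * p := by congr 1; omega
        _ < _ := by rw [add_mul]; omega)
  refine ⟨Φ, h1, fun k hk => mem_degreeLE.1 (h2 k hk), ?_, fun τ hτ => ?_⟩
  · rw [h3, ← hdeg]
    exact charpoly_monic _
  · have h : (C τ : ℂ[X]) * C τ⁻¹ = 1 := by rw [← C_mul, mul_inv_cancel₀ hτ, C_1]
    rw [D_eq_eval_charpoly, ← hP, h4 _ _ h, C_add]

/-- The polynomials `D(·, τ)` determine `D`. -/
theorem D_eq_of_forall_ne_zero {J J' : PeriodicJacobi m p}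
    (h : ∀ τ : ℂ, τ ≠ 0 → J.D (X : ℂ[X]) (C τ) = J'.D (X : ℂ[X]) (C τ)) (z τ : ℂ) :
    J.D z τ = J'.D z τ := by
  have h2 : (J.monodromy z).charpoly = (J'.monodromy z).charpoly := by
    refine eq_of_infinite_eval_eq _ _ ?_
    refine (Set.finite_singleton (0 : ℂ)).infinite_compl.mono fun τ hτ => ?_
    rw [Set.mem_ofPred_eq, ← D_eq_eval_charpoly, ← D_eq_eval_charpoly, ← D_eval, ← D_eval, h τ hτ]
  rw [D_eq_eval_charpoly, h2, ← D_eq_eval_charpoly]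

theorem exp_add_inv (x : ℝ) :
    Complex.exp (x * Complex.I) + (Complex.exp (x * Complex.I))⁻¹ = 2 * (Real.cos x : ℂ) := by
  rw [← Complex.exp_neg, Complex.ofReal_cos, Complex.cos, neg_mul]
  ring

/-- The data determine `D`. The polynomials `Φ` of two operators, divided by the leading
coefficients of `D` in `z`, have a difference to which the interpolation argument applies. -/
theorem D_eq_of_hasData [NeZero p] {ϰ : Fin (m + 1) → ℝ}
    (hϰ : ∀ i j, i ≠ j → Real.cos (ϰ i) ≠ Real.cos (ϰ j)) {Λ : Fin (m + 1) → Multiset ℂ}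
    (hΛ : ∀ j, j ≠ 0 → (Λ j).card = (m - (j : ℕ)) * p + 1) {J J' : PeriodicJacobi m p}
    (hJ : J.HasData ϰ Λ) (hJ' : J'.HasData ϰ Λ) (z τ : ℂ) : J.D z τ = J'.D z τ := by
  obtain ⟨Φ, hΦ0, hΦd, hΦ1, hΦ⟩ := J.exists_reduced
  obtain ⟨Φ', hΦ0', hΦd', hΦ1', hΦ'⟩ := J'.exists_reduced
  have hred : ∀ (J : PeriodicJacobi m p) (Φ : ℂ[X][X]),
      (∀ τ : ℂ, τ ≠ 0 → J.D (X : ℂ[X]) (C τ) = C τ ^ m * Φ.eval (C (τ + τ⁻¹))) →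
      ∀ τ : ℂ, τ ≠ 0 → C (J.detConst : ℂ)⁻¹ * Φ.eval (C (τ + τ⁻¹)) =
        (J.floquet τ τ⁻¹).charpoly := by
    intro J Φ hΦ τ hτ
    have h := hΦ τ hτ
    rw [D_X_eq_charpoly J hτ] at h
    have h1 : (C τ : ℂ[X]) ^ m ≠ 0 := pow_ne_zero _ (C_ne_zero.2 hτ)
    have h2 : C (J.detConst : ℂ)⁻¹ * C (J.detConst : ℂ) = 1 := by
      rw [← C_mul, inv_mul_cancel₀ (Complex.ofReal_ne_zero.2 J.detConst_ne_zero), C_1]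
    refine mul_left_cancel₀ h1 ?_
    rw [C_mul, C_pow] at h
    linear_combination (-C (J.detConst : ℂ)⁻¹) * h +
      (C τ ^ m * (J.floquet τ τ⁻¹).charpoly) * h2
  set Ψ : ℂ[X][X] := C (C (J.detConst : ℂ)⁻¹) * Φ - C (C (J'.detConst : ℂ)⁻¹) * Φ' with hΨ
  have hΨe : ∀ τ : ℂ, τ ≠ 0 → Ψ.eval (C (τ + τ⁻¹)) =
      (J.floquet τ τ⁻¹).charpoly - (J'.floquet τ τ⁻¹).charpoly := fun τ hτ => by
    rw [hΨ, eval_sub, eval_mul, eval_mul, eval_C, eval_C, hred J Φ hΦ τ hτ, hred J' Φ' hΦ' τ hτ]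
  let ι : ℕ → Fin (m + 1) := fun j => Fin.ofNat (m + 1) j
  have hι : ∀ j, j ≤ m → (ι j : ℕ) = j := fun j hj => Nat.mod_eq_of_lt (Nat.lt_succ_of_le hj)
  let e : ℕ → ℂ := fun j => Complex.exp (ϰ (ι j) * Complex.I)
  have he : ∀ j, e j ≠ 0 := fun j => Complex.exp_ne_zero _
  -- at `j = 0` the difference vanishes, and every polynomial of the required degree is a factor
  let q : ℕ → ℂ[X] := fun j => if j = 0 then X ^ (m * p + 1) else
    ((Λ (ι j)).map fun a => X - C a).prod
  have hΨ0 : Ψ = 0 := by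
    refine eq_zero_of_dvd_eval p m (fun j => e j + (e j)⁻¹) q Ψ ?_ ?_ ?_ ?_ ?_
    · intro i hi j hj hij
      simp only [e, exp_add_inv] at hij
      by_contra hne
      refine hϰ (ι i) (ι j) (fun h => hne ?_) ?_
      · rw [← hι i hi, ← hι j hj, h]
      · exact_mod_cast mul_left_cancel₀ two_ne_zero hij
    · intro j hj
      by_cases h0 : j = 0
      · simp only [q, h0, if_true, degree_X_pow, Nat.sub_zero]
      · have h1 : ι j ≠ 0 := fun h => h0 (by rw [← hι j hj, h]; rfl)
        simp only [q, h0, if_false]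
        rw [degree_multiset_prod, Multiset.map_map]
        simp only [Function.comp_def, degree_X_sub_C, Multiset.map_const', Multiset.sum_replicate]
        rw [hΛ _ h1, hι j hj]
        simp
    · intro k hk
      simp [hΨ, hΦ0 k hk, hΦ0' k hk]
    · intro j hj
      rw [hΨ, coeff_sub, coeff_C_mul, coeff_C_mul, C_mul', C_mul']
      exact (degree_sub_le _ _).trans (max_le ((degree_smul_le _ _).trans (hΦd j hj))
        ((degree_smul_le _ _).trans (hΦd' j hj)))
    · intro j hj
      rw [hΨe _ (he j)]
      by_cases h0 : j = 0
      · have h1 : ι j = 0 := Fin.ext (by rw [hι j hj, h0]; rfl)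
        have hr : (J.floquet (e j) (e j)⁻¹).charpoly.roots =
            (J'.floquet (e j) (e j)⁻¹).charpoly.roots := by
          rw [← zeros_eq J (he j), ← zeros_eq J' (he j)]
          simp only [e, h1]
          rw [← hJ.1, ← hJ'.1]
        have hc : (J.floquet (e j) (e j)⁻¹).charpoly = (J'.floquet (e j) (e j)⁻¹).charpoly := by
          rw [(IsAlgClosed.splits _).eq_prod_roots_of_monic (charpoly_monic _), hr,
            ← (IsAlgClosed.splits _).eq_prod_roots_of_monic (charpoly_monic _)]
        rw [hc, sub_self]
        exact dvd_zero _
      · have h1 : ι j ≠ 0 := fun h => h0 (by rw [← hι j hj, h]; rfl)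
        simp only [q, h0, if_false]
        refine dvd_sub ?_ ?_
        · rw [Multiset.prod_X_sub_C_dvd_iff_le_roots (charpoly_monic _).ne_zero,
            ← zeros_eq J (he j)]
          exact hJ.2 _ h1
        · rw [Multiset.prod_X_sub_C_dvd_iff_le_roots (charpoly_monic _).ne_zero,
            ← zeros_eq J' (he j)]
          exact hJ'.2 _ h1
  -- the leading coefficient in the second variable shows that the constants agree
  have hcc : (J.detConst : ℂ)⁻¹ = (J'.detConst : ℂ)⁻¹ := by
    have h : Ψ.coeff m = 0 := by rw [hΨ0, coeff_zero]
    rw [hΨ, coeff_sub, coeff_C_mul, coeff_C_mul, hΦ1, hΦ1', mul_one, mul_one, sub_eq_zero] at h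
    exact C_injective h
  refine D_eq_of_forall_ne_zero (fun τ hτ => ?_) z τ
  have h := hΨe τ hτ
  rw [hΨ0, eval_zero, eq_comm, sub_eq_zero] at h
  rw [D_X_eq_charpoly J hτ, D_X_eq_charpoly J' hτ, h, inv_inj.1 hcc]

theorem isLyapunov_iff_of_D_eq {J J' : PeriodicJacobi m p} (h : ∀ z τ : ℂ, J.D z τ = J'.D z τ)
    (Δ : Fin m → ℂ → ℂ) : J.IsLyapunov Δ ↔ J'.IsLyapunov Δ := by
  have hc : ∀ z : ℂ, (J.modMonodromy z).charpoly = (J'.modMonodromy z).charpoly := fun z =>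
    Polynomial.funext fun τ => by
      rw [← D_eq_eval_charpoly_modMonodromy, ← D_eq_eval_charpoly_modMonodromy, h]
  simp only [IsLyapunov, hc]

theorem zeros_eq_of_D_eq {J J' : PeriodicJacobi m p} (h : ∀ z τ : ℂ, J.D z τ = J'.D z τ) (τ : ℂ) :
    J.zeros τ = J'.zeros τ := by
  have : J.D (X : ℂ[X]) (C τ) = J'.D (X : ℂ[X]) (C τ) :=
    Polynomial.funext fun z => by rw [D_eval, D_eval, h]
  rw [zeros, zeros, this]

end

end PeriodicJacobi

/-! ### Bloch sequences and the Floquet matrix -/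

namespace PeriodicJacobi

noncomputable section

open Matrix

variable {m p : ℕ}

theorem floquet_apply {R : Type*} [CommRing R] [Algebra ℝ R] (J : PeriodicJacobi m p) (t t' : R)
    (r k : Fin p) (i j : Fin m) : J.floquet t t' (r, i) (k, j) =
      cyc p t r k * algebraMap ℝ R (J.a ((r : ℕ) + 1) i j) +
        (if r = k then algebraMap ℝ R (J.b ((r : ℕ) + 1) i j) else 0) +
        cyc p t' k r * algebraMap ℝ R (J.a ((k : ℕ) + 1) j i) := by
  simp [floquet, mul_apply, siteDiag, Fintype.sum_prod_type, kroneckerMap_apply, one_apply,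
    mul_comm]

/-- On sequences with the Bloch condition `y_{n+p} = t y_n`, with values in a module over the ring
of the parameter `t`, the Floquet matrix acts by the Jacobi difference expression. -/
theorem sum_floquet_smul {R H : Type*} [CommRing R] [Algebra ℝ R] [AddCommGroup H] [Module R H]
    (J : PeriodicJacobi m p) {t t' : R} (ht : t * t' = 1) {y : ℤ → Fin m → H}
    (hy : ∀ n j, y (n + p) j = t • y n j) (r : Fin p) (i : Fin m) :
    ∑ x : Fin p × Fin m, J.floquet t t' (r, i) x • y ((x.1 : ℕ) + 1) x.2 =
      ∑ j, algebraMap ℝ R (J.a ((r : ℕ) + 1) i j) • y ((r : ℕ) + 1 + 1) j +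
        ∑ j, algebraMap ℝ R (J.b ((r : ℕ) + 1) i j) • y ((r : ℕ) + 1) j +
        ∑ j, algebraMap ℝ R (J.a (r : ℕ) j i) • y (r : ℕ) j := by
  have h1 : ∀ j, ∑ k : Fin p, cyc p t r k • y ((k : ℕ) + 1) j = y ((r : ℕ) + 1 + 1) j := by
    intro j
    rw [sum_cyc_smul t r fun k => y ((k : ℕ) + 1) j]
    split_ifs with h
    · push_cast; rfl
    · have hr : (r : ℕ) + 1 = p := by omega
      have hr' : ((r : ℕ) : ℤ) + 1 + 1 = 1 + p := by omega
      rw [hr', hy]; simp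
  have h2 : ∀ j, ∑ k : Fin p, cyc p t' k r •
      (algebraMap ℝ R (J.a ((k : ℕ) + 1) j i) • y ((k : ℕ) + 1) j) =
      algebraMap ℝ R (J.a (r : ℕ) j i) • y (r : ℕ) j := by
    intro j
    rw [sum_cyc_transpose_smul t' r fun k : Fin p =>
      algebraMap ℝ R (J.a ((k : ℕ) + 1) j i) • y ((k : ℕ) + 1) j]
    have hp : ((p - 1 : ℕ) : ℤ) + 1 = 0 + p := by have := r.pos; omega
    split_ifs with h
    · rw [hp, hy, J.a_periodic, h, smul_comm t', smul_smul t', mul_comm t', ht, one_smul]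
      simp
    · have hr : (((r : ℕ) - 1 : ℕ) : ℤ) + 1 = (r : ℕ) := by omega
      simp only [hr]
  rw [Fintype.sum_prod_type_right]
  simp only [floquet_apply, add_smul, Finset.sum_add_distrib]
  congr 1
  · congr 1
    · refine Finset.sum_congr rfl fun j _ => ?_
      rw [← h1 j, Finset.smul_sum]
      refine Finset.sum_congr rfl fun k _ => ?_
      rw [smul_smul, mul_comm]
    · refine Finset.sum_congr rfl fun j _ => ?_
      simp [ite_smul]
  · refine Finset.sum_congr rfl fun j _ => ?_
    rw [← h2 j]
    refine Finset.sum_congr rfl fun k _ => ?_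
    rw [smul_smul]

theorem act_apply (A : Matrix (Fin m) (Fin m) ℝ) (v : EuclideanSpace ℂ (Fin m)) (i : Fin m) :
    act A v i = ∑ j, (A i j : ℂ) * v j := by
  simp [act, mulVec, dotProduct]

theorem diffExpr_apply (J : PeriodicJacobi m p) (y : ℤ → EuclideanSpace ℂ (Fin m)) (n : ℤ)
    (i : Fin m) : J.diffExpr y n i = ∑ j, (J.a n i j : ℂ) * y (n + 1) j +
      ∑ j, (J.b n i j : ℂ) * y n j + ∑ j, (J.a (n - 1) j i : ℂ) * y (n - 1) j := by
  simp only [diffExpr, PiLp.add_apply, act_apply, transpose_apply]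

theorem act_injective {A : Matrix (Fin m) (Fin m) ℝ} (hA : A.det ≠ 0) :
    Function.Injective (act A) := by
  have h : ∀ v, act A⁻¹ (act A v) = v := fun v => by
    have : act A⁻¹ * act A = 1 := by
      rw [act, act, ← map_mul, ← Matrix.map_mul, nonsing_inv_mul _ (IsUnit.mk0 _ hA)]
      simp
    exact DFunLike.congr_fun this v
  exact Function.LeftInverse.injective h

theorem periodic_add_int_mul {α : Type*} {c : ℤ → α} (hc : ∀ n, c (n + p) = c n) (n k : ℤ) :
    c (n + k * p) = c n := by
  have h := (show Function.Periodic c (p : ℤ) from hc).int_mul k n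
  simpa using h

/-- The solutions `y` with the Bloch condition `y_{n+p} = τ y_n`. -/
def blochSolutions (J : PeriodicJacobi m p) (z τ : ℂ) :
    Submodule ℂ (ℤ → EuclideanSpace ℂ (Fin m)) where
  carrier := {y | J.diffExpr y = z • y ∧ ∀ n, y (n + p) = τ • y n}
  zero_mem' := ⟨by ext; simp [diffExpr], by simp⟩
  add_mem' := by
    rintro x y ⟨hx, hx'⟩ ⟨hy, hy'⟩
    refine ⟨?_, fun n => by simp [hx', hy']⟩
    rw [smul_add, ← hx, ← hy]
    funext n
    simp only [diffExpr, Pi.add_apply, map_add]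
    abel
  smul_mem' := by
    rintro c y ⟨hy, hy'⟩
    refine ⟨?_, fun n => by simp [hy', smul_comm c τ]⟩
    rw [smul_comm, ← hy]
    funext n
    simp only [diffExpr, Pi.smul_apply, map_smul, smul_add]

theorem bloch_zpow {E : Type*} [AddCommGroup E] [Module ℂ E] {τ : ℂ} (hτ : τ ≠ 0) {y : ℤ → E}
    (hy : ∀ n, y (n + p) = τ • y n) (n k : ℤ) : y (n + k * p) = τ ^ k • y n := by
  induction k using Int.induction_on with
  | zero => simp
  | succ k ih =>
    rw [add_mul, one_mul, ← add_assoc, hy, ih, smul_smul, zpow_add₀ hτ, zpow_one, mul_comm]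
  | pred k ih =>
    have h := hy (n + (-(k : ℤ) - 1) * p)
    rw [show n + (-(k : ℤ) - 1) * p + p = n + -(k : ℤ) * p by ring, ih] at h
    rw [zpow_sub₀ hτ, zpow_one, div_eq_inv_mul, ← smul_smul, h, smul_smul, inv_mul_cancel₀ hτ,
      one_smul]

theorem exists_site [NeZero p] (n : ℤ) : ∃ (r : Fin p) (k : ℤ), n = (r : ℕ) + 1 + k * p := by
  have hp : (0 : ℤ) < p := by exact_mod_cast Nat.pos_of_ne_zero (NeZero.ne p)
  have h0 := Int.emod_nonneg (n - 1) hp.ne'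
  have h1 := Int.emod_lt_of_pos (n - 1) hp
  refine ⟨⟨((n - 1) % p).toNat, by omega⟩, (n - 1) / p, ?_⟩
  simp only [Int.toNat_of_nonneg h0]
  have := Int.emod_add_mul_ediv (n - 1) p
  linarith [mul_comm (p : ℤ) ((n - 1) / p)]

theorem bloch_ext [NeZero p] {E : Type*} [AddCommGroup E] [Module ℂ E] {τ : ℂ} (hτ : τ ≠ 0)
    {y y' : ℤ → E} (hy : ∀ n, y (n + p) = τ • y n) (hy' : ∀ n, y' (n + p) = τ • y' n)
    (h : ∀ r : Fin p, y ((r : ℕ) + 1) = y' ((r : ℕ) + 1)) : y = y' := by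
  funext n
  obtain ⟨r, k, rfl⟩ := exists_site (p := p) n
  rw [bloch_zpow hτ hy, bloch_zpow hτ hy', h]

theorem diffExpr_bloch (J : PeriodicJacobi m p) {τ : ℂ} {y : ℤ → EuclideanSpace ℂ (Fin m)}
    (hy : ∀ n, y (n + p) = τ • y n) (n : ℤ) : J.diffExpr y (n + p) = τ • J.diffExpr y n := by
  simp only [diffExpr]
  rw [add_right_comm n, hy, hy, ← sub_add_eq_add_sub, hy, J.a_periodic, J.a_periodic, J.b_periodic,
    map_smul, map_smul, map_smul, smul_add, smul_add]

/-- A sequence with the Bloch condition is a solution if and only if its restriction to one period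
is in the kernel of the Floquet matrix minus `z`. -/
theorem bloch_solution_iff [NeZero p] (J : PeriodicJacobi m p) (z : ℂ) {τ : ℂ} (hτ : τ ≠ 0)
    {y : ℤ → EuclideanSpace ℂ (Fin m)} (hy : ∀ n, y (n + p) = τ • y n) :
    J.diffExpr y = z • y ↔
      (J.floquet τ τ⁻¹ - z • 1) *ᵥ (fun x : Fin p × Fin m => y ((x.1 : ℕ) + 1) x.2) = 0 := by
  have h1 : ∀ (r : Fin p) (i : Fin m), ((J.floquet τ τ⁻¹ - z • 1) *ᵥ
      (fun x : Fin p × Fin m => y ((x.1 : ℕ) + 1) x.2)) (r, i) =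
      J.diffExpr y ((r : ℕ) + 1) i - z * y ((r : ℕ) + 1) i := fun r i => by
    have h := J.sum_floquet_smul (mul_inv_cancel₀ hτ) (y := fun n j => y n j)
      (fun n j => by simp [hy]) r i
    rw [sub_mulVec, smul_mulVec, one_mulVec, diffExpr_apply, add_sub_cancel_right]
    exact congrArg (· - _) h
  constructor
  · intro h
    ext ⟨r, i⟩
    rw [h1, h]
    simp
  · intro h
    refine bloch_ext hτ (J.diffExpr_bloch hy) (fun n => by simp [hy, smul_comm z τ]) fun r => ?_
    ext i
    have := congrFun h (r, i)
    rw [h1, Pi.zero_apply, sub_eq_zero] at this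
    simp [this]

theorem finrank_blochSolutions [NeZero p] (J : PeriodicJacobi m p) (z : ℂ) {τ : ℂ} (hτ : τ ≠ 0) :
    Module.finrank ℂ (J.blochSolutions z τ) =
      Module.finrank ℂ (LinearMap.ker (J.floquet τ τ⁻¹ - z • 1).mulVecLin) := by
  let f : J.blochSolutions z τ →ₗ[ℂ] LinearMap.ker (J.floquet τ τ⁻¹ - z • 1).mulVecLin :=
    { toFun := fun y => ⟨fun x : Fin p × Fin m => y.1 ((x.1 : ℕ) + 1) x.2,
        (J.bloch_solution_iff z hτ y.2.2).1 y.2.1⟩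
      map_add' := fun _ _ => rfl
      map_smul' := fun _ _ => rfl }
  refine (LinearEquiv.ofBijective f ⟨?_, ?_⟩).finrank_eq
  · intro y y' h
    refine Subtype.ext (bloch_ext hτ y.2.2 y'.2.2 fun r => ?_)
    ext i
    exact congrFun (congrArg Subtype.val h) (r, i)
  · rintro ⟨x, hx⟩
    have hp : (0 : ℤ) < p := by exact_mod_cast Nat.pos_of_ne_zero (NeZero.ne p)
    have hlt : ∀ n : ℤ, ((n - 1) % p).toNat < p := fun n => by
      have h0 := Int.emod_nonneg (n - 1) hp.ne'
      have h1 := Int.emod_lt_of_pos (n - 1) hp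
      omega
    let y : ℤ → EuclideanSpace ℂ (Fin m) := fun n =>
      τ ^ ((n - 1) / (p : ℤ)) • WithLp.toLp 2 fun j => x (⟨((n - 1) % p).toNat, hlt n⟩, j)
    have hy : ∀ n, y (n + p) = τ • y n := fun n => by
      have e1 : n + (p : ℤ) - 1 = n - 1 + p := by ring
      simp only [y, e1, Int.add_emod_right, Int.add_ediv_of_dvd_right (dvd_refl (p : ℤ)),
        Int.ediv_self hp.ne']
      rw [zpow_add₀ hτ, zpow_one, mul_comm, smul_smul]
    have hyx : ∀ (r : Fin p) (i : Fin m), y ((r : ℕ) + 1) i = x (r, i) := fun r i => by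
      have hr0 : (0 : ℤ) ≤ (r : ℕ) := Int.natCast_nonneg _
      have hr1 : ((r : ℕ) : ℤ) < p := by exact_mod_cast r.2
      have e1 : ((r : ℕ) : ℤ) + 1 - 1 = (r : ℕ) := by ring
      simp only [y, e1, Int.ediv_eq_zero_of_lt hr0 hr1, zpow_zero, one_smul,
        Int.emod_eq_of_lt hr0 hr1, Int.toNat_natCast]
    have hyx' : (fun x : Fin p × Fin m => y ((x.1 : ℕ) + 1) x.2) = x :=
      funext fun ⟨r, i⟩ => hyx r i
    refine ⟨⟨y, (J.bloch_solution_iff z hτ hy).2 ?_, hy⟩, Subtype.ext hyx'⟩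
    rw [hyx']
    exact hx

/-! ### Geometric and algebraic multiplicity -/

/-- For Hermitian matrices geometric and algebraic multiplicities agree. -/
theorem finrank_ker_sub_eq_count {n : Type*} [Fintype n] [DecidableEq n] {A : Matrix n n ℂ}
    (hA : A.IsHermitian) (z : ℂ) :
    Module.finrank ℂ (LinearMap.ker (A - z • 1).mulVecLin) = A.charpoly.roots.count z := by
  have h1 : A - z • 1 = (hA.eigenvectorUnitary : Matrix n n ℂ) *
      diagonal (fun i => (hA.eigenvalues i : ℂ) - z) *
      (star hA.eigenvectorUnitary : Matrix n n ℂ) := by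
    have h2 : diagonal (fun i => (hA.eigenvalues i : ℂ) - z) =
        diagonal (RCLike.ofReal ∘ hA.eigenvalues) - z • 1 := by
      rw [smul_one_eq_diagonal, diagonal_sub]; rfl
    rw [h2, mul_sub, sub_mul, mul_smul_comm, mul_one, smul_mul_assoc]
    congr 1
    · conv_lhs => rw [hA.spectral_theorem, Unitary.conjStarAlgAut_apply]
    · exact congrArg _ (Unitary.coe_mul_star_self _).symm
  have hr : (A - z • 1).rank = Fintype.card {i // (hA.eigenvalues i : ℂ) - z ≠ 0} := by
    rw [h1, rank_mul_eq_left_of_isUnit_det, rank_mul_eq_right_of_isUnit_det, rank_diagonal]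
    · exact (Matrix.isUnit_iff_isUnit_det _).1 (Unitary.toUnits hA.eigenvectorUnitary).isUnit
    · exact (Matrix.isUnit_iff_isUnit_det _).1 (Unitary.toUnits (star hA.eigenvectorUnitary)).isUnit
  have h3 := LinearMap.finrank_range_add_finrank_ker (A - z • 1).mulVecLin
  rw [← Matrix.rank, hr, Module.finrank_fintype_fun_eq_card] at h3
  have h4 : A.charpoly.roots.count z = Fintype.card {i // ¬ (hA.eigenvalues i : ℂ) - z ≠ 0} := by
    rw [hA.roots_charpoly_eq_eigenvalues, Multiset.count_map, Fintype.card_subtype,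
      Finset.card_def, Finset.filter_val]
    congr 1
    refine Multiset.filter_congr fun i _ => ?_
    rw [not_not, sub_eq_zero]
    exact eq_comm
  rw [h4, Fintype.card_subtype_compl]
  omega

theorem floquet_isHermitian (J : PeriodicJacobi m p) {τ : ℂ} (hτ : ‖τ‖ = 1) :
    (J.floquet τ τ⁻¹).IsHermitian := by
  have h : star τ = τ⁻¹ := by
    rw [Complex.inv_def, Complex.normSq_eq_norm_sq, hτ]; simp
  have h1 := J.floquet_map (Complex.conjAe : ℂ →ₐ[ℝ] ℂ) τ τ⁻¹
  have h2 : (Complex.conjAe : ℂ →ₐ[ℝ] ℂ) τ = τ⁻¹ := h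
  have h3 : (Complex.conjAe : ℂ →ₐ[ℝ] ℂ) τ⁻¹ = τ := by rw [map_inv₀, h2, inv_inv]
  rw [h2, h3] at h1
  change ((J.floquet τ τ⁻¹)ᵀ.map (Complex.conjAe : ℂ →ₐ[ℝ] ℂ)) = _
  rw [transpose_map, h1, floquet_transpose]

/-- On the unit circle the multiplicity of `z` as a zero of `D(·, τ)` is the number of linearly
independent Bloch solutions. -/
theorem finrank_blochSolutions_eq_count [NeZero p] (J : PeriodicJacobi m p) (z : ℂ) {τ : ℂ}
    (hτ : ‖τ‖ = 1) :
    Module.finrank ℂ (J.blochSolutions z τ) = (J.zeros τ).count z := by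
  have h0 : τ ≠ 0 := fun h => by simp [h] at hτ
  rw [finrank_blochSolutions J z h0, finrank_ker_sub_eq_count (J.floquet_isHermitian hτ),
    zeros_eq J h0]

end

end PeriodicJacobi

/-! ### The multiplicity of the spectrum -/

namespace PeriodicJacobi

noncomputable section

open Matrix

variable {m p : ℕ}

theorem diffExpr_translate (J : PeriodicJacobi m p) (y : ℤ → EuclideanSpace ℂ (Fin m)) :
    J.diffExpr (fun n => y (n + p)) = fun n => J.diffExpr y (n + p) := by
  funext n
  simp only [diffExpr]
  rw [J.a_periodic, J.b_periodic, ← sub_add_eq_add_sub, J.a_periodic, add_right_comm n 1,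
    sub_add_eq_add_sub n 1]

/-- The shift by one period on the bounded solutions. -/
def translate (J : PeriodicJacobi m p) (z : ℂ) : Module.End ℂ (J.boundedSolutions z) where
  toFun y := ⟨fun n => y.1 (n + p), by
    rw [diffExpr_translate, y.2.1]; rfl, y.2.2.imp fun _ h n => h _⟩
  map_add' _ _ := rfl
  map_smul' _ _ := rfl

/-- A solution is determined by its values at two consecutive points. -/
theorem solution_eq_zero (J : PeriodicJacobi m p) {z : ℂ} {y : ℤ → EuclideanSpace ℂ (Fin m)}
    (hy : J.diffExpr y = z • y) (h0 : y 0 = 0) (h1 : y 1 = 0) : y = 0 := by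
  have h : ∀ n : ℤ, y n = 0 ∧ y (n + 1) = 0 := by
    intro n
    induction n using Int.induction_on with
    | zero => exact ⟨h0, h1⟩
    | succ n ih =>
      refine ⟨ih.2, ?_⟩
      have h := congrFun hy (n + 1)
      rw [diffExpr, Pi.smul_apply, ih.2, add_sub_cancel_right, ih.1, map_zero, map_zero, smul_zero,
        add_zero, add_zero] at h
      exact act_injective (J.a_det _) (h.trans (map_zero _).symm)
    | pred n ih =>
      refine ⟨?_, by rw [sub_add_cancel]; exact ih.1⟩
      have h := congrFun hy (-n)
      rw [diffExpr, Pi.smul_apply, ih.2, ih.1, map_zero, map_zero, smul_zero, zero_add,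
        zero_add] at h
      refine act_injective ?_ (h.trans (map_zero _).symm)
      rw [det_transpose]
      exact J.a_det _
  exact funext fun n => (h n).1

instance (J : PeriodicJacobi m p) (z : ℂ) : FiniteDimensional ℂ (J.boundedSolutions z) := by
  let f : J.boundedSolutions z →ₗ[ℂ] EuclideanSpace ℂ (Fin m) × EuclideanSpace ℂ (Fin m) :=
    { toFun := fun y => (y.1 0, y.1 1)
      map_add' := fun _ _ => rfl
      map_smul' := fun _ _ => rfl }
  refine FiniteDimensional.of_injective f ((injective_iff_map_eq_zero f).2 fun y hy => ?_)
  exact Subtype.ext (J.solution_eq_zero y.2.1 (congrArg Prod.fst hy) (congrArg Prod.snd hy))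

/-- The multipliers of the bounded Bloch solutions are on the unit circle, as the powers `τ ^ k`,
`k ∈ ℤ`, are bounded. -/
theorem norm_eq_one_of_translate (J : PeriodicJacobi m p) {z τ : ℂ} {y : J.boundedSolutions z}
    (hy : J.translate z y = τ • y) (hy0 : y ≠ 0) : ‖τ‖ = 1 := by
  have hy' : ∀ n, y.1 (n + p) = τ • y.1 n := fun n => congrFun (congrArg Subtype.val hy) n
  obtain ⟨n, hn⟩ : ∃ n, y.1 n ≠ 0 := by
    by_contra! h
    exact hy0 (Subtype.ext (funext h))
  have hτ : τ ≠ 0 := fun h => by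
    refine hn ?_
    rw [← sub_add_cancel n (p : ℤ), hy', h, zero_smul]
  obtain ⟨C, hC⟩ := y.2.2
  have hb : ∀ k : ℤ, ‖τ‖ ^ k ≤ C / ‖y.1 n‖ := fun k => by
    rw [le_div_iff₀ (norm_pos_iff.2 hn), ← norm_zpow, ← norm_smul, ← bloch_zpow hτ hy']
    exact hC _
  have hle : ∀ x : ℝ, (∀ k : ℕ, x ^ k ≤ C / ‖y.1 n‖) → x ≤ 1 := fun x hx => by
    by_contra! h
    obtain ⟨k, hk⟩ := pow_unbounded_of_one_lt (C / ‖y.1 n‖) h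
    exact absurd (hx k) (not_le.2 hk)
  refine le_antisymm (hle _ fun k => by simpa using hb k) ?_
  have h := hle ‖τ‖⁻¹ fun k => by simpa using hb (-k)
  exact (inv_le_one₀ (norm_pos_iff.2 hτ)).1 h

theorem exists_bound_bloch [NeZero p] {E : Type*} [NormedAddCommGroup E] [NormedSpace ℂ E] {τ : ℂ}
    (hτ : ‖τ‖ = 1) {y : ℤ → E} (hy : ∀ n, y (n + p) = τ • y n) : ∃ C : ℝ, ∀ n, ‖y n‖ ≤ C := by
  have h0 : τ ≠ 0 := fun h => by simp [h] at hτ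
  refine ⟨∑ r : Fin p, ‖y ((r : ℕ) + 1)‖, fun n => ?_⟩
  obtain ⟨r, k, rfl⟩ := exists_site (p := p) n
  rw [bloch_zpow h0 hy, norm_smul, norm_zpow, hτ, _root_.one_zpow, one_mul]
  exact Finset.single_le_sum (f := fun r : Fin p => ‖y ((r : ℕ) + 1)‖)
    (fun _ _ => norm_nonneg _) (Finset.mem_univ r)

theorem finrank_eigenspace_translate [NeZero p] (J : PeriodicJacobi m p) (z : ℂ) (τ : ℂ) :
    Module.finrank ℂ ((J.translate z).eigenspace τ) =
      if ‖τ‖ = 1 then (J.zeros τ).count z else 0 := by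
  split_ifs with hτ
  · have h : ((J.translate z).eigenspace τ).map (J.boundedSolutions z).subtype =
        J.blochSolutions z τ := by
      ext y
      constructor
      · rintro ⟨y, hy, rfl⟩
        rw [SetLike.mem_coe, Module.End.mem_eigenspace_iff] at hy
        exact ⟨y.2.1, fun n => congrFun (congrArg Subtype.val hy) n⟩
      · rintro ⟨hy, hy'⟩
        refine ⟨⟨y, hy, exists_bound_bloch hτ hy'⟩, ?_, rfl⟩
        rw [SetLike.mem_coe, Module.End.mem_eigenspace_iff]
        exact Subtype.ext (funext hy')
    rw [← finrank_blochSolutions_eq_count J z hτ, ← h, Submodule.finrank_map_subtype_eq]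
  · have h : (J.translate z).eigenspace τ = ⊥ := by
      refine (Submodule.eq_bot_iff _).2 fun y hy => ?_
      by_contra hy0
      exact hτ (J.norm_eq_one_of_translate (Module.End.mem_eigenspace_iff.1 hy) hy0)
    rw [h, finrank_bot]

/-- The shift on the bounded solutions has no Jordan blocks: these would produce solutions which
grow linearly. -/
theorem translate_sub_eq_zero (J : PeriodicJacobi m p) {z τ : ℂ} {y : J.boundedSolutions z}
    (hy : ((J.translate z - τ • 1 : Module.End ℂ (J.boundedSolutions z)) ^ 2) y = 0) :
    (J.translate z - τ • 1) y = 0 := by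
  set w := (J.translate z - τ • 1) y with hw
  have hw' : J.translate z w = τ • w := by
    rw [sq, Module.End.mul_apply, ← hw] at hy
    simpa [sub_eq_zero] using hy
  by_contra hw0
  have hτ := J.norm_eq_one_of_translate hw' hw0
  have h0 : τ ≠ 0 := fun h => by simp [h] at hτ
  obtain ⟨n, hn⟩ : ∃ n, w.1 n ≠ 0 := by
    by_contra! h
    exact hw0 (Subtype.ext (funext h))
  have hy1 : ∀ n, y.1 (n + p) = τ • y.1 n + w.1 n := fun n => by
    have : J.translate z y = τ • y + w := by rw [hw]; simp
    exact congrFun (congrArg Subtype.val this) n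
  have hw1 : ∀ n, w.1 (n + p) = τ • w.1 n := fun n => congrFun (congrArg Subtype.val hw') n
  have hgrow : ∀ k : ℕ, y.1 (n + k * p) = τ ^ k • (y.1 n + ((k : ℂ) * τ⁻¹) • w.1 n) := by
    intro k
    induction k with
    | zero => simp
    | succ k ih =>
      have e : n + ((k + 1 : ℕ) : ℤ) * p = n + k * p + p := by push_cast; ring
      have hk := bloch_zpow h0 hw1 n k
      rw [zpow_natCast] at hk
      rw [e, hy1, ih, hk, smul_smul, ← pow_succ', smul_add, smul_add, smul_smul, smul_smul,
        add_assoc, ← add_smul]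
      congr 2
      push_cast
      field_simp
      ring
  obtain ⟨C, hC⟩ := y.2.2
  obtain ⟨k, hk⟩ := exists_nat_gt (2 * C / ‖w.1 n‖)
  rw [div_lt_iff₀ (norm_pos_iff.2 hn)] at hk
  have h1 := hC (n + k * p)
  rw [hgrow, norm_smul, norm_pow, hτ, one_pow, one_mul] at h1
  have h2 := norm_sub_le (y.1 n + ((k : ℂ) * τ⁻¹) • w.1 n) (y.1 n)
  rw [add_sub_cancel_left, norm_smul, norm_mul, norm_inv, hτ, inv_one, mul_one,
    Complex.norm_natCast] at h2
  have h3 := hC n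
  linarith

/-- The shift by one period on the bounded solutions is diagonalizable. -/
theorem iSup_eigenspace_translate (J : PeriodicJacobi m p) (z : ℂ) :
    ⨆ τ, (J.translate z).eigenspace τ = ⊤ := by
  rw [← Module.End.iSup_maxGenEigenspace_eq_top (J.translate z)]
  refine iSup_congr fun τ => le_antisymm (J.translate z).eigenspace_le_maxGenEigenspace ?_
  intro y hy
  rw [Module.End.mem_maxGenEigenspace] at hy
  obtain ⟨k, hk⟩ := hy
  have h1 : LinearMap.ker ((J.translate z - τ • 1) ^ 1) =
      LinearMap.ker ((J.translate z - τ • 1) ^ (1 : ℕ).succ) := by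
    ext x
    rw [LinearMap.mem_ker, LinearMap.mem_ker, pow_one]
    refine ⟨fun h => ?_, J.translate_sub_eq_zero⟩
    rw [pow_succ, pow_one, Module.End.mul_apply, h, map_zero]
  have h2 : y ∈ LinearMap.ker ((J.translate z - τ • 1) ^ 1) := by
    rw [Module.End.ker_pow_constant h1 k, LinearMap.mem_ker, pow_add, pow_one, Module.End.mul_apply,
      hk, map_zero]
  rw [Module.End.mem_eigenspace_iff, ← sub_eq_zero]
  simpa using h2

/-- The multiplicity of the spectrum at `z` is the sum of the multiplicities of `z` as a zero of
`D(·, τ)` over the `τ` on the unit circle; in particular it is determined by `D`. -/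
theorem multiplicity_eq_of_D_eq [NeZero p] {J J' : PeriodicJacobi m p}
    (h : ∀ z τ : ℂ, J.D z τ = J'.D z τ) (z : ℂ) : J.multiplicity z = J'.multiplicity z := by
  classical
  have e : ∀ J : PeriodicJacobi m p, Nonempty ((DirectSum ℂ fun τ => (J.translate z).eigenspace τ)
      ≃ₗ[ℂ] J.boundedSolutions z) := fun J =>
    ⟨LinearEquiv.ofBijective (DirectSum.coeLinearMap _)
      (DirectSum.isInternal_submodule_of_iSupIndep_of_iSup_eq_top
        (J.translate z).eigenspaces_iSupIndep (J.iSup_eigenspace_translate z))⟩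
  have hf : ∀ τ, Module.finrank ℂ ((J.translate z).eigenspace τ) =
      Module.finrank ℂ ((J'.translate z).eigenspace τ) := fun τ => by
    rw [finrank_eigenspace_translate, finrank_eigenspace_translate, zeros_eq_of_D_eq h]
  have e' : ∀ τ, (J.translate z).eigenspace τ ≃ₗ[ℂ] (J'.translate z).eigenspace τ := fun τ =>
    have := Module.Free.of_divisionRing ℂ ((J.translate z).eigenspace τ)
    have := Module.Free.of_divisionRing ℂ ((J'.translate z).eigenspace τ)
    LinearEquiv.ofFinrankEq _ _ (hf τ)
  exact ((e J).some.symm.trans ((DFinsupp.mapRange.linearEquiv e').trans (e J').some)).finrank_eq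

end

end PeriodicJacobi

/-! ### The spectrum -/

namespace PeriodicJacobi

noncomputable section

open Matrix Polynomial LaurentPolynomial

variable {m p : ℕ}

/-! #### Matrices over a commutative ring acting on vectors with entries in a module -/

section MatAct

variable {R H N : Type*} [CommRing R] [AddCommGroup H] [Module R H] [Fintype N]

/-- The action of a matrix over `R` on vectors with entries in an `R`-module. -/
def matAct (A : Matrix N N R) (x : N → H) : N → H := fun i => ∑ j, A i j • x j

theorem matAct_mul (A B : Matrix N N R) (x : N → H) : matAct (A * B) x = matAct A (matAct B x) := by
  funext i
  simp only [matAct, mul_apply, Finset.sum_smul, Finset.smul_sum, mul_smul]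
  exact Finset.sum_comm

theorem matAct_smul_one [DecidableEq N] (c : R) (x : N → H) :
    matAct (c • (1 : Matrix N N R)) x = c • x := by
  funext i
  simp [matAct, one_apply, ite_smul]

theorem matAct_smul (A : Matrix N N R) (c : R) (x : N → H) :
    matAct A (c • x) = c • matAct A x := by
  funext i
  simp only [matAct, Pi.smul_apply, Finset.smul_sum, smul_comm c]

theorem matAct_smul_const (A : Matrix N N R) (v : N → R) (h : H) :
    matAct A (fun i => v i • h) = fun i => (A *ᵥ v) i • h := by
  funext i
  simp only [matAct, mulVec, dotProduct, Finset.sum_smul, mul_smul]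

theorem matAct_bijective [DecidableEq N] {A : Matrix N N R}
    (hA : Function.Bijective fun h : H => A.det • h) :
    Function.Bijective (matAct A : (N → H) → N → H) := by
  constructor
  · intro x y hxy
    have h : A.det • x = A.det • y := by
      rw [← matAct_smul_one, ← matAct_smul_one, ← adjugate_mul, matAct_mul, matAct_mul, hxy]
    exact funext fun i => hA.1 (congrFun h i)
  · intro y
    choose x hx using fun i => hA.2 (y i)
    refine ⟨matAct A.adjugate x, ?_⟩
    rw [← matAct_mul, mul_adjugate, matAct_smul_one]
    exact funext hx

end MatAct

/-! #### The shift on scalar sequences -/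

theorem norm_shift_le (m : ℕ) (k : ℤ) : ‖shift m k‖ ≤ 1 :=
  LinearMap.mkContinuous_norm_le _ zero_le_one _

/-- The shift by one, as an invertible operator. -/
def shiftUnit (m : ℕ) : (SeqSpace m →L[ℂ] SeqSpace m)ˣ where
  val := shift m 1
  inv := shift m (-1)
  val_inv := by
    ext y n
    rw [mul_apply_eq_comp, shift_apply, shift_apply, add_neg_cancel_right]; rfl
  inv_val := by
    ext y n
    rw [mul_apply_eq_comp, shift_apply, shift_apply, neg_add_cancel_right]; rfl

instance : Nontrivial (SeqSpace 1) := by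
  refine ⟨lp.single 2 0 (EuclideanSpace.single 0 1), 0, fun h => ?_⟩
  have := congrArg (fun y : SeqSpace 1 => y 0 0) h
  simp at this

theorem norm_eq_one_of_mem_spectrum_shift {τ : ℂ}
    (hτ : τ ∈ spectrum ℂ (shiftUnit 1 : SeqSpace 1 →L[ℂ] SeqSpace 1)) : ‖τ‖ = 1 := by
  have h0 : τ ≠ 0 := fun h => spectrum.zero_notMem ℂ (shiftUnit 1).isUnit (h ▸ hτ)
  have h1 := (spectrum.norm_le_norm_of_mem hτ).trans (norm_shift_le 1 1)
  have h2 : τ⁻¹ ∈ spectrum ℂ ((shiftUnit 1)⁻¹ : (SeqSpace 1 →L[ℂ] SeqSpace 1)ˣ).1 := by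
    have := (spectrum.inv_mem_iff (r := Units.mk0 τ h0) (a := shiftUnit 1)).1 hτ
    simpa using this
  have h3 := (spectrum.norm_le_norm_of_mem h2).trans (norm_shift_le 1 (-1))
  rw [norm_inv, inv_le_one₀ (norm_pos_iff.2 h0)] at h3
  exact le_antisymm h1 h3

/-- Laurent polynomials act on scalar sequences: the variable acts as the shift. -/
def laurentHom : ℂ[T;T⁻¹] →ₐ[ℂ] (SeqSpace 1 →L[ℂ] SeqSpace 1) :=
  AddMonoidAlgebra.lift ℂ (SeqSpace 1 →L[ℂ] SeqSpace 1) ℤ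
    ((Units.coeHom _).comp (zpowersHom _ (shiftUnit 1)))

theorem laurentHom_T (n : ℤ) :
    laurentHom (T n) = ((shiftUnit 1 ^ n : (SeqSpace 1 →L[ℂ] SeqSpace 1)ˣ) : _ →L[ℂ] _) := by
  change AddMonoidAlgebra.lift _ _ _ _ (AddMonoidAlgebra.single n 1) = _
  rw [AddMonoidAlgebra.lift_single, one_smul]
  simp

/-- Scalar sequences as a module over the Laurent polynomials in the shift. -/
instance : Module ℂ[T;T⁻¹] (SeqSpace 1) := Module.compHom (SeqSpace 1) laurentHom.toRingHom

theorem laurent_smul (f : ℂ[T;T⁻¹]) (h : SeqSpace 1) : f • h = laurentHom f h := rfl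

theorem algebraMap_laurent_smul (r : ℝ) (h : SeqSpace 1) :
    algebraMap ℝ ℂ[T;T⁻¹] r • h = (r : ℂ) • h := by
  have : algebraMap ℝ ℂ[T;T⁻¹] r = algebraMap ℂ ℂ[T;T⁻¹] (r : ℂ) := rfl
  rw [laurent_smul, this, AlgHom.commutes]
  rfl

theorem C_laurent_smul (z : ℂ) (h : SeqSpace 1) : (LaurentPolynomial.C z) • h = z • h := by
  rw [laurent_smul, LaurentPolynomial.C_eq_algebraMap, AlgHom.commutes]
  rfl

theorem T_laurent_smul (h : SeqSpace 1) (k : ℤ) : ((T 1 : ℂ[T;T⁻¹]) • h) k = h (k + 1) := by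
  rw [laurent_smul, laurentHom_T, zpow_one]
  rfl

/-- The operator `S - τ`, where `S` is the shift and `|τ| = 1`, is not surjective. -/
theorem not_surjective_shift_sub {τ : ℂ} (hτ : ‖τ‖ = 1) :
    ¬ Function.Surjective fun h : SeqSpace 1 => (T 1 - LaurentPolynomial.C τ : ℂ[T;T⁻¹]) • h := by
  intro hs
  obtain ⟨h, hh⟩ := hs (lp.single 2 0 (EuclideanSpace.single 0 1))
  have he : ∀ k, h (k + 1) - τ • h k =
      (lp.single 2 0 (EuclideanSpace.single 0 1) : SeqSpace 1) k := fun k => by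
    rw [← hh]
    simp only [sub_smul, C_laurent_smul]
    rw [lp.coeFn_sub, Pi.sub_apply, T_laurent_smul]
    rfl
  have hsum : Summable fun k => ‖h k‖ ^ (2 : ENNReal).toReal :=
    (memℓp_gen_iff (by norm_num)).1 (lp.memℓp h)
  have hstep : ∀ k, k ≠ 0 → ‖h (k + 1)‖ = ‖h k‖ := fun k hk => by
    have := he k
    rw [lp.single_apply_ne _ _ _ hk, sub_eq_zero] at this
    rw [this, norm_smul, hτ, one_mul]
  have hz : ∀ (f : ℕ → ℤ), Function.Injective f → (∀ k, ‖h (f k)‖ = ‖h (f 0)‖) → h (f 0) = 0 := by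
    intro f hf hc
    have h1 := hsum.comp_injective hf
    simp only [Function.comp_def, hc, summable_const_iff] at h1
    simpa using h1
  have h1 : h 1 = 0 := by
    refine hz (fun k => (k : ℤ) + 1) (fun a b hab => by simpa using hab) fun k => ?_
    induction k with
    | zero => rfl
    | succ k ih => rw [Nat.cast_succ, hstep _ (by omega), ih]
  have h0 : h 0 = 0 := by
    refine hz (fun k => -(k : ℤ)) (fun a b hab => by simpa using hab) fun k => ?_
    induction k with
    | zero => rfl
    | succ k ih =>
      have := hstep (-((k + 1 : ℕ) : ℤ)) (by omega)
      rw [show -((k + 1 : ℕ) : ℤ) + 1 = -(k : ℤ) by push_cast; ring] at this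
      exact this.symm.trans ih
  have := he 0
  rw [zero_add, h1, h0, lp.single_apply_self] at this
  simpa using congrArg (fun v => v 0) this

/-! #### Decomposition of sequences into cells -/

/-- The scalar sequence `k ↦ (y_{n+kp})_j`. -/
def component [NeZero p] (y : SeqSpace m) (n : ℤ) (j : Fin m) : SeqSpace 1 :=
  ⟨fun k => EuclideanSpace.single 0 (y (n + k * p) j), by
    have h := (memℓp_gen_iff (p := 2) (by norm_num)).1 (lp.memℓp y)
    have hp : (p : ℤ) ≠ 0 := by exact_mod_cast NeZero.ne p
    have hi : Function.Injective fun k : ℤ => n + k * p := fun a b hab =>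
      mul_right_cancel₀ hp (add_left_cancel hab)
    refine memℓp_gen ((h.comp_injective hi).of_nonneg_of_le (fun _ => by positivity) fun k => ?_)
    refine Real.rpow_le_rpow (norm_nonneg _) ?_ (by norm_num)
    rw [PiLp.norm_single]
    exact PiLp.norm_apply_le _ _⟩

theorem component_apply [NeZero p] (y : SeqSpace m) (n : ℤ) (j : Fin m) (k : ℤ) :
    component (p := p) y n j k = EuclideanSpace.single 0 (y (n + k * p) j) := rfl

theorem component_add_period [NeZero p] (y : SeqSpace m) (n : ℤ) (j : Fin m) :
    component (p := p) y (n + p) j = (T 1 : ℂ[T;T⁻¹]) • component (p := p) y n j := by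
  ext1
  funext k
  rw [T_laurent_smul, component_apply, component_apply]
  rw [add_assoc, add_mul, one_mul, add_comm (k * (p : ℤ))]

/-- The positions `r + 1 + kp`, `0 ≤ r < p`, enumerate the integers. -/
def siteEquiv (p : ℕ) [NeZero p] : Fin p × ℤ ≃ ℤ :=
  Equiv.ofBijective (fun x => (x.1 : ℕ) + 1 + x.2 * p) ⟨by
    rintro ⟨r, k⟩ ⟨s, l⟩ h
    simp only at h
    have hr : ((r : ℕ) : ℤ) = ((r : ℕ) : ℤ) % p :=
      (Int.emod_eq_of_lt (Int.natCast_nonneg _) (by exact_mod_cast r.2)).symm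
    have hs : ((s : ℕ) : ℤ) = ((s : ℕ) : ℤ) % p :=
      (Int.emod_eq_of_lt (Int.natCast_nonneg _) (by exact_mod_cast s.2)).symm
    have hrs : ((r : ℕ) : ℤ) = (s : ℕ) := by
      rw [hr, hs, ← Int.add_mul_emod_self_right (r : ℕ) k p,
        ← Int.add_mul_emod_self_right (s : ℕ) l p]
      congr 1
      linarith
    have hp : (p : ℤ) ≠ 0 := by exact_mod_cast NeZero.ne p
    have hkl : k * (p : ℤ) = l * p := by linarith
    rw [Prod.mk.injEq]
    exact ⟨Fin.ext (by exact_mod_cast hrs), mul_right_cancel₀ hp hkl⟩, fun n => by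
    obtain ⟨r, k, h⟩ := exists_site (p := p) n
    exact ⟨(r, k), h.symm⟩⟩

theorem siteEquiv_apply [NeZero p] (r : Fin p) (k : ℤ) :
    siteEquiv p (r, k) = (r : ℕ) + 1 + k * p := rfl

/-- The decomposition of a sequence into the scalar sequences `k ↦ (y_{r+1+kp})_j`. -/
def cells [NeZero p] (y : SeqSpace m) : Fin p × Fin m → SeqSpace 1 :=
  fun x => component (p := p) y ((x.1 : ℕ) + 1) x.2

theorem cells_bijective [NeZero p] :
    Function.Bijective (cells : SeqSpace m → Fin p × Fin m → SeqSpace 1) := by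
  constructor
  · intro y y' h
    ext1
    funext n
    obtain ⟨r, k, rfl⟩ := exists_site (p := p) n
    ext j
    have := congrArg (fun v : SeqSpace 1 => v k 0) (congrFun h (r, j))
    simpa [cells, component_apply] using this
  · intro x
    let y : ℤ → EuclideanSpace ℂ (Fin m) := fun n =>
      WithLp.toLp 2 fun j => x (((siteEquiv p).symm n).1, j) ((siteEquiv p).symm n).2 0
    have hy : Memℓp y 2 := by
      refine memℓp_gen ?_
      rw [← (siteEquiv p).summable_iff]
      refine (summable_prod_of_nonneg
        (f := (fun n => ‖y n‖ ^ (2 : ENNReal).toReal) ∘ siteEquiv p)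
        fun _ => Real.rpow_nonneg (norm_nonneg _) _).2 ⟨fun r => ?_, Summable.of_finite⟩
      have hx : ∀ j, Summable fun k => ‖x (r, j) k‖ ^ (2 : ENNReal).toReal := fun j =>
        (memℓp_gen_iff (by norm_num)).1 (lp.memℓp (x (r, j)))
      refine (summable_sum (s := Finset.univ) fun j _ => hx j).congr fun k => ?_
      simp [y, EuclideanSpace.norm_sq_eq]
    refine ⟨⟨y, hy⟩, ?_⟩
    funext ⟨r, j⟩
    ext1
    funext k
    ext i
    obtain rfl : i = 0 := Subsingleton.elim _ _
    rw [cells, component_apply]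
    simp [y, ← siteEquiv_apply]

/-- In terms of cells, `𝓙 - z` is the Floquet matrix minus `z` with the shift as its parameter. -/
theorem cells_op_sub [NeZero p] (J : PeriodicJacobi m p) (z : ℂ) (y : SeqSpace m) :
    cells ((J.op - z • 1) y) =
      matAct (J.floquet (T 1 : ℂ[T;T⁻¹]) (T (-1)) - LaurentPolynomial.C z • 1) (cells y) := by
  have hT : (T 1 : ℂ[T;T⁻¹]) * T (-1) = 1 := by rw [← T_add, add_neg_cancel, T_zero]
  funext ⟨r, i⟩
  have h := J.sum_floquet_smul hT (y := fun n j => component (p := p) y n j)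
    (fun n j => component_add_period y n j) r i
  have h1 : matAct (J.floquet (T 1 : ℂ[T;T⁻¹]) (T (-1)) - LaurentPolynomial.C z • 1)
      (cells y) (r, i) = ∑ x : Fin p × Fin m, J.floquet (T 1 : ℂ[T;T⁻¹]) (T (-1)) (r, i) x •
      component (p := p) y ((x.1 : ℕ) + 1) x.2 - z • component (p := p) y ((r : ℕ) + 1) i := by
    simp only [matAct, Matrix.sub_apply, sub_smul, Finset.sum_sub_distrib]
    congr 1
    have := congrFun (matAct_smul_one (N := Fin p × Fin m) (LaurentPolynomial.C z)
      (cells (p := p) y)) (r, i)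
    rw [matAct] at this
    rw [this, Pi.smul_apply, C_laurent_smul]
    rfl
  rw [h1, h]
  simp only [algebraMap_laurent_smul]
  ext1
  funext k
  ext l
  obtain rfl : l = 0 := Subsingleton.elim _ _
  rw [cells, component_apply]
  have ha := periodic_add_int_mul (c := J.a) J.a_periodic
  have hb := periodic_add_int_mul (c := J.b) J.b_periodic
  have e1 : ((r : ℕ) : ℤ) + 1 + k * p + 1 = (r : ℕ) + 1 + 1 + k * p := by ring
  have e2 : ((r : ℕ) : ℤ) + 1 + k * p - 1 = (r : ℕ) + k * p := by ring
  have hop : ((J.op - z • 1) y) ((r : ℕ) + 1 + k * p) i =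
      J.diffExpr y ((r : ℕ) + 1 + k * p) i - z * y ((r : ℕ) + 1 + k * p) i := rfl
  rw [hop, diffExpr_apply, ha, hb, e1, e2, ha]
  simp only [lp.coeFn_sub, lp.coeFn_add, lp.coeFn_smul, lp.coeFn_sum, Pi.sub_apply, Pi.add_apply,
    Finset.sum_apply, Pi.smul_apply, component_apply]
  simp [WithLp.ofLp_sum]

/-! #### Invertibility -/

theorem isUnit_op_sub_iff [NeZero p] (J : PeriodicJacobi m p) (z : ℂ) : IsUnit (J.op - z • 1) ↔
    Function.Bijective (matAct (H := SeqSpace 1)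
      (J.floquet (T 1 : ℂ[T;T⁻¹]) (T (-1)) - LaurentPolynomial.C z • 1)) := by
  rw [ContinuousLinearMap.isUnit_iff_bijective,
    ← cells_bijective.of_comp_iff, ← (cells_bijective (p := p)).of_comp_iff']
  have : cells (p := p) ∘ ⇑(J.op - z • 1) = matAct (H := SeqSpace 1)
      (J.floquet (T 1 : ℂ[T;T⁻¹]) (T (-1)) - LaurentPolynomial.C z • 1) ∘ cells (p := p) :=
    funext fun y => J.cells_op_sub z y
  rw [this]

/-- If `D(z, ·)` has no zero on the unit circle, which contains the spectrum of the shift `S`, then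
`D(z, S)` is invertible by the spectral mapping theorem. Hence so is the determinant of the Floquet
matrix minus `z` with parameter `S`, and the adjugate yields an inverse of `𝓙 - z`. -/
theorem isUnit_op_sub [NeZero p] (J : PeriodicJacobi m p) {z : ℂ}
    (h : ∀ τ : ℂ, ‖τ‖ = 1 → J.D z τ ≠ 0) : IsUnit (J.op - z • 1) := by
  rw [isUnit_op_sub_iff]
  refine matAct_bijective ?_
  set A := J.floquet (T 1 : ℂ[T;T⁻¹]) (T (-1)) - LaurentPolynomial.C z • 1 with hA
  have hT : (T 1 : ℂ[T;T⁻¹]) * T (-1) = 1 := by rw [← T_add, add_neg_cancel, T_zero]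
  have h1 : IsUnit (laurentHom (J.D (LaurentPolynomial.C z) (T 1))) := by
    have e1 : J.D (LaurentPolynomial.C z) (T 1) =
        toLaurentAlg (J.D (Polynomial.C z) (X : ℂ[X])) := by
      have := J.D_map (toLaurentAlg.restrictScalars ℝ : ℂ[X] →ₐ[ℝ] ℂ[T;T⁻¹]) (Polynomial.C z) X
      simpa using this.symm
    have e2 : laurentHom.comp toLaurentAlg = aeval (shiftUnit 1 : SeqSpace 1 →L[ℂ] SeqSpace 1) := by
      ext1
      simp [laurentHom_T]
    rw [e1, ← AlgHom.comp_apply, e2, ← spectrum.zero_notMem_iff ℂ, spectrum.map_polynomial_aeval]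
    rintro ⟨τ, hτ, h0⟩
    refine h τ (norm_eq_one_of_mem_spectrum_shift hτ) ?_
    have := J.D_map ((aeval τ).restrictScalars ℝ : ℂ[X] →ₐ[ℝ] ℂ) (Polynomial.C z) X
    simp only [AlgHom.restrictScalars_apply, aeval_C, aeval_X] at this
    rw [coe_aeval_eq_eval] at this
    exact this.symm.trans h0
  have h2 : IsUnit (laurentHom A.det) := by
    have hu : IsUnit (algebraMap ℝ ℂ[T;T⁻¹] J.detConst * (T 1) ^ m) :=
      ((IsUnit.mk0 _ J.detConst_ne_zero).map _).mul ((isUnit_T 1).pow m)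
    have e := J.D_eq_det_floquet (LaurentPolynomial.C z) hT
    obtain ⟨u, hu⟩ := hu
    have e' : A.det = (-1) ^ Fintype.card (Fin p × Fin m) * (↑u⁻¹ *
        J.D (LaurentPolynomial.C z) (T 1)) := by
      rw [e, ← hu, Units.inv_mul_cancel_left, hA, ← neg_sub, det_neg]
    rw [e', map_mul, map_mul]
    exact ((isUnit_one.neg.pow _).map _).mul ((u⁻¹.isUnit.map _).mul h1)
  exact (ContinuousLinearMap.isUnit_iff_bijective.1 h2)

theorem sub_dvd_floquet_sub {R : Type*} [CommRing R] [Algebra ℝ R] (J : PeriodicJacobi m p)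
    {t t' s s' : R} (ht : t * t' = 1) (hs : s * s' = 1) (x y : Fin p × Fin m) :
    t - s ∣ J.floquet t t' x y - J.floquet s s' x y := by
  have h1 : ∀ r k, t - s ∣ cyc p t r k - cyc p s r k := fun r k => by
    simp only [cyc, of_apply]
    split_ifs <;> simp
  have h2 : ∀ r k, t - s ∣ cyc p t' r k - cyc p s' r k := fun r k => by
    have h3 : t - s ∣ t' - s' := ⟨-(t' * s'), by linear_combination s' * ht - t' * hs⟩
    simp only [cyc, of_apply]
    split_ifs <;> simp [h3]
  obtain ⟨r, i⟩ := x
  obtain ⟨k, j⟩ := y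
  rw [floquet_apply, floquet_apply]
  have h := dvd_add ((h1 r k).mul_right (algebraMap ℝ R (J.a ((r : ℕ) + 1) i j)))
    ((h2 k r).mul_right (algebraMap ℝ R (J.a ((k : ℕ) + 1) j i)))
  convert h using 1
  ring

/-- Let `D(z, τ) = 0`, `|τ| = 1`, and let `v` be a nonzero vector with `floquet τ v = z v`. If
`A(S)` is the Floquet matrix minus `z` with the shift `S` as its parameter, then all entries of
`A(S) v` are divisible by `S - τ`. Were `A(S)` bijective, every `v h` would lie in the range of
`S - τ`, which is not all of `ℓ²`. -/
theorem not_isUnit_op_sub [NeZero p] (J : PeriodicJacobi m p) {z τ : ℂ} (hτ : ‖τ‖ = 1)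
    (h : J.D z τ = 0) : ¬ IsUnit (J.op - z • 1) := by
  have h0 : τ ≠ 0 := fun h => by simp [h] at hτ
  rw [isUnit_op_sub_iff]
  intro hb
  set A := J.floquet (T 1 : ℂ[T;T⁻¹]) (T (-1)) - LaurentPolynomial.C z • 1 with hA
  have hT : (T 1 : ℂ[T;T⁻¹]) * T (-1) = 1 := by rw [← T_add, add_neg_cancel, T_zero]
  have hdet : (J.floquet τ τ⁻¹ - z • 1).det = 0 := by
    rw [det_floquet_sub J z (mul_inv_cancel₀ h0), h, mul_zero]
  obtain ⟨v, hv0, hv⟩ := exists_mulVec_eq_zero_iff.2 hdet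
  obtain ⟨x₀, hx₀⟩ : ∃ x, v x ≠ 0 := by
    by_contra! h
    exact hv0 (funext h)
  have hmap : (J.floquet τ τ⁻¹ - z • 1).map LaurentPolynomial.C =
      J.floquet (LaurentPolynomial.C τ) (LaurentPolynomial.C τ⁻¹) -
        LaurentPolynomial.C z • 1 := by
    have h1 := J.floquet_map ((Algebra.ofId ℂ ℂ[T;T⁻¹]).restrictScalars ℝ) τ τ⁻¹
    rw [Matrix.map_sub _ (map_sub _)]
    congr 1
    ext x y
    simp [one_apply, apply_ite]
  have hdvd : ∀ x, T 1 - LaurentPolynomial.C τ ∣ (A *ᵥ fun y => LaurentPolynomial.C (v y)) x := by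
    intro x
    have h1 : (A *ᵥ fun y => LaurentPolynomial.C (v y)) x =
        ∑ y, (J.floquet (T 1 : ℂ[T;T⁻¹]) (T (-1)) x y -
          J.floquet (LaurentPolynomial.C τ) (LaurentPolynomial.C τ⁻¹) x y) *
          LaurentPolynomial.C (v y) := by
      have h2 : ((J.floquet τ τ⁻¹ - z • 1).map LaurentPolynomial.C *ᵥ
          fun y => LaurentPolynomial.C (v y)) x = 0 := by
        have := congrArg LaurentPolynomial.C (congrFun hv x)
        simpa [mulVec, dotProduct] using this
      rw [hmap] at h2
      rw [← sub_zero ((A *ᵥ _) x), ← h2, hA]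
      simp only [mulVec, dotProduct, ← Finset.sum_sub_distrib, Matrix.sub_apply]
      refine Finset.sum_congr rfl fun y _ => ?_
      ring
    rw [h1]
    refine Finset.dvd_sum fun y _ => (J.sub_dvd_floquet_sub hT ?_ x y).mul_right _
    rw [← map_mul, mul_inv_cancel₀ h0, map_one]
  choose g hg using hdvd
  refine not_surjective_shift_sub hτ fun h => ?_
  obtain ⟨x, hx⟩ := hb.2 fun i => g i • h
  have h1 : matAct A (fun i => LaurentPolynomial.C (v i) • h) =
      matAct A ((T 1 - LaurentPolynomial.C τ : ℂ[T;T⁻¹]) • x) := by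
    rw [matAct_smul_const, matAct_smul, hx]
    funext i
    rw [hg, mul_smul, Pi.smul_apply]
  have h2 := congrFun (hb.1 h1) x₀
  refine ⟨LaurentPolynomial.C (v x₀)⁻¹ • x x₀, ?_⟩
  change (T 1 - LaurentPolynomial.C τ : ℂ[T;T⁻¹]) • LaurentPolynomial.C (v x₀)⁻¹ • x x₀ = h
  rw [smul_comm, ← Pi.smul_apply _ x x₀, ← h2, ← mul_smul, ← map_mul, inv_mul_cancel₀ hx₀,
    map_one, one_smul]

/-- The spectrum consists of the `z` for which `D(z, ·)` has a zero on the unit circle. -/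
theorem mem_spectrum_op_iff [NeZero p] (J : PeriodicJacobi m p) (z : ℂ) :
    z ∈ spectrum ℂ J.op ↔ ∃ τ : ℂ, ‖τ‖ = 1 ∧ J.D z τ = 0 := by
  rw [spectrum.mem_iff, ← IsUnit.neg_iff, neg_sub, Algebra.algebraMap_eq_smul_one]
  constructor
  · intro h
    by_contra! h'
    exact h (J.isUnit_op_sub h')
  · rintro ⟨τ, hτ, h⟩
    exact J.not_isUnit_op_sub hτ h

end

end PeriodicJacobi

/-! ### Families of operators sharing most of the data -/

namespace PeriodicJacobi

noncomputable section

open Matrix Polynomial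

variable {p : ℕ}

/-- The Floquet matrix of the scalar operator with constant off-diagonal coefficient `ε` and
diagonal coefficients `β`. -/
def scalarFloquet (ε : ℝ) (β : Fin p → ℝ) (τ : ℂ) : Matrix (Fin p) (Fin p) ℂ :=
  (ε : ℂ) • (cyc p τ + (cyc p τ⁻¹)ᵀ) + diagonal fun k => (β k : ℂ)

theorem scalarFloquet_isHermitian (ε : ℝ) (β : Fin p → ℝ) {τ : ℂ} (hτ : ‖τ‖ = 1) :
    (scalarFloquet ε β τ).IsHermitian := by
  have h : star τ = τ⁻¹ := by
    rw [Complex.inv_def, Complex.normSq_eq_norm_sq, hτ]; simp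
  have h1 : ∀ t : ℂ, (cyc p t)ᴴ = (cyc p (star t))ᵀ := fun t => by
    have := cyc_map (p := p) (starRingEnd ℂ) t
    rw [conjTranspose, transpose_map]
    exact congrArg transpose this
  have h1' : ∀ t : ℂ, (cyc p t)ᵀᴴ = cyc p (star t) := fun t => by
    rw [conjTranspose, transpose_transpose]
    exact cyc_map (p := p) (starRingEnd ℂ) t
  have h2 : (diagonal fun k => (β k : ℂ))ᴴ = diagonal fun k => (β k : ℂ) := by
    rw [diagonal_conjTranspose]
    congr 1
    funext k
    exact Complex.conj_ofReal _
  rw [IsHermitian, scalarFloquet, conjTranspose_add, h2, conjTranspose_smul, conjTranspose_add,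
    h1, h1', star_inv₀, h, inv_inv, add_comm (cyc p τ)]
  congr 2
  exact Complex.conj_ofReal _

/-- The values of the characteristic polynomial of `scalarFloquet` at the nodes `0, …, p - 1`. -/
def nodeValues (p : ℕ) (τ : ℂ) (x : ℝ × (Fin p → ℝ)) : Fin p → ℝ := fun k =>
  ((((k : ℕ) : ℂ) • 1 - scalarFloquet x.1 x.2 τ).det).re

theorem contDiff_nodeValues (τ : ℂ) : ContDiff ℝ 1 (nodeValues p τ) := by
  rw [contDiff_pi]
  intro k
  refine Complex.reCLM.contDiff.comp ?_
  simp only [det_apply]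
  refine ContDiff.sum fun σ _ => ContDiff.const_smul _ (contDiff_prod fun i _ => ?_)
  have h : (fun x : ℝ × (Fin p → ℝ) => (((k : ℕ) : ℂ) • 1 - scalarFloquet x.1 x.2 τ) (σ i) i) =
      fun x => (((k : ℕ) : ℂ) • (1 : Matrix (Fin p) (Fin p) ℂ)) (σ i) i -
        ((x.1 : ℂ) * (cyc p τ + (cyc p τ⁻¹)ᵀ) (σ i) i +
          if σ i = i then (x.2 (σ i) : ℂ) else 0) := by
    funext x
    simp only [scalarFloquet, Matrix.sub_apply, Matrix.add_apply, Matrix.smul_apply, smul_eq_mul,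
      diagonal_apply]
  rw [h]
  have h1 : ContDiff ℝ 1 fun x : ℝ × (Fin p → ℝ) => (x.1 : ℂ) :=
    Complex.ofRealCLM.contDiff.comp contDiff_fst
  have h2 : ContDiff ℝ 1 fun x : ℝ × (Fin p → ℝ) => (x.2 (σ i) : ℂ) :=
    Complex.ofRealCLM.contDiff.comp ((contDiff_apply ℝ ℝ (σ i)).comp contDiff_snd)
  refine contDiff_const.sub ((h1.mul contDiff_const).add ?_)
  split_ifs
  · exact h2
  · exact contDiff_const

theorem nodeValues_zero (τ : ℂ) (β : Fin p → ℝ) (k : Fin p) :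
    nodeValues p τ (0, β) k = ∏ l : Fin p, (((k : ℕ) : ℝ) - β l) := by
  have : (((k : ℕ) : ℂ) • 1 - scalarFloquet 0 β τ) =
      diagonal fun l => ((((k : ℕ) : ℝ) - β l : ℝ) : ℂ) := by
    rw [scalarFloquet, Complex.ofReal_zero, zero_smul, zero_add, smul_one_eq_diagonal, diagonal_sub]
    simp
  rw [nodeValues, this, det_diagonal, ← Complex.ofReal_prod, Complex.ofReal_re]

/-- The zeros of `nodeValues` correspond to the operators with the eigenvalues `0, …, p - 1`: the
values of the characteristic polynomial at real points are real, as the matrix is Hermitian. -/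
theorem charpoly_scalarFloquet_eq {τ : ℂ} (hτ : ‖τ‖ = 1) {ε : ℝ} {β : Fin p → ℝ}
    (h : nodeValues p τ (ε, β) = 0) :
    (scalarFloquet ε β τ).charpoly = ∏ k : Fin p, (X - C ((k : ℕ) : ℂ)) := by
  have hm : (∏ k : Fin p, (X - C ((k : ℕ) : ℂ))).Monic := monic_prod_X_sub_C _ _
  have hd : (∏ k : Fin p, (X - C ((k : ℕ) : ℂ))).degree = ((p : ℕ) : WithBot ℕ) := by
    rw [degree_prod]; simp only [degree_X_sub_C]; simp
  have hd' : (scalarFloquet ε β τ).charpoly.degree = ((p : ℕ) : WithBot ℕ) := by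
    rw [charpoly_degree_eq_dim, Fintype.card_fin]
  refine eq_of_degree_sub_lt_of_eval_finset_eq
    (Finset.univ.image fun k : Fin p => ((k : ℕ) : ℂ)) ?_ ?_
  · rw [Finset.card_image_of_injective _ fun a b hab => Fin.ext (by exact_mod_cast hab),
      Finset.card_univ, Fintype.card_fin, ← hd']
    exact degree_sub_lt_left (hd'.trans hd.symm) (charpoly_monic _).ne_zero
      ((charpoly_monic _).leadingCoeff.trans hm.leadingCoeff.symm)
  · intro x hx
    obtain ⟨k, -, rfl⟩ := Finset.mem_image.1 hx
    have h1 : eval ((k : ℕ) : ℂ) (∏ k : Fin p, (X - C ((k : ℕ) : ℂ))) = 0 := by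
      rw [eval_prod]
      exact Finset.prod_eq_zero (Finset.mem_univ k) (by simp)
    rw [h1, eval_charpoly, scalar_apply, ← smul_one_eq_diagonal]
    have hherm : (((k : ℕ) : ℂ) • 1 - scalarFloquet ε β τ).IsHermitian := by
      refine IsHermitian.sub ?_ (scalarFloquet_isHermitian ε β hτ)
      rw [IsHermitian, conjTranspose_smul, conjTranspose_one]
      simp
    have h2 : star ((((k : ℕ) : ℂ) • 1 - scalarFloquet ε β τ).det) =
        (((k : ℕ) : ℂ) • 1 - scalarFloquet ε β τ).det := by
      rw [← det_conjTranspose, hherm]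
    refine Complex.ext (congrFun h k) ?_
    exact Complex.conj_eq_iff_im.1 h2

/-- For all small `ε` there are diagonal coefficients for which the Floquet matrix at `τ` has the
eigenvalues `0, …, p - 1`: at `ε = 0` the matrix is diagonal, and there the derivative of
`nodeValues` with respect to the diagonal coefficients is diagonal and invertible. -/
theorem eventually_exists_charpoly_eq {τ : ℂ} (hτ : ‖τ‖ = 1) :
    ∀ᶠ ε : ℝ in nhds 0, ∃ β : Fin p → ℝ,
      (scalarFloquet ε β τ).charpoly = ∏ k : Fin p, (X - C ((k : ℕ) : ℂ)) := by
  set β₀ : Fin p → ℝ := fun k => (k : ℕ) with hβ₀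
  set x₀ : ℝ × (Fin p → ℝ) := (0, β₀) with hx₀
  set F' := fderiv ℝ (nodeValues p τ) x₀
  have hF : HasStrictFDerivAt (nodeValues p τ) F' x₀ :=
    (contDiff_nodeValues τ).contDiffAt.hasStrictFDerivAt (by norm_num)
  set G : ℝ × (Fin p → ℝ) → ℝ × (Fin p → ℝ) := fun x => (x.1, nodeValues p τ x) with hG
  have hG' : HasStrictFDerivAt G ((ContinuousLinearMap.fst ℝ ℝ (Fin p → ℝ)).prod F') x₀ :=
    hasStrictFDerivAt_fst.prodMk hF
  have hline : ∀ (v : Fin p → ℝ) (k : Fin p),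
      F' (0, v) k = -v k * ∏ l ∈ Finset.univ.erase k, (((k : ℕ) : ℝ) - (l : ℕ)) := by
    intro v k
    have h1 : HasDerivAt (fun t : ℝ => ((0 : ℝ), β₀ + t • v)) ((0 : ℝ), v) 0 := by
      refine (hasDerivAt_const _ _).prodMk ?_
      simpa using ((hasDerivAt_id (0 : ℝ)).smul_const v).const_add β₀
    have h2 : HasFDerivAt (nodeValues p τ) F' ((0 : ℝ), β₀ + (0 : ℝ) • v) := by
      simpa [hx₀] using hF.hasFDerivAt
    have h3 := hasDerivAt_pi.1 (h2.comp_hasDerivAt (0 : ℝ) h1) k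
    have h4 : HasDerivAt (fun t : ℝ => (-(t * v k)) *
        ∏ l ∈ Finset.univ.erase k, (((k : ℕ) : ℝ) - ((l : ℕ) + t * v l)))
        (-v k * ∏ l ∈ Finset.univ.erase k, (((k : ℕ) : ℝ) - (l : ℕ))) 0 := by
      have hd : DifferentiableAt ℝ (fun t : ℝ =>
          ∏ l ∈ Finset.univ.erase k, (((k : ℕ) : ℝ) - ((l : ℕ) + t * v l))) 0 := by
        fun_prop
      have h5 : HasDerivAt (fun t : ℝ => -(t * v k)) (-v k) 0 := by
        simpa using ((hasDerivAt_id (0 : ℝ)).mul_const (v k)).fun_neg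
      simpa using h5.fun_mul hd.hasDerivAt
    refine h3.unique (h4.congr_of_eventuallyEq (Filter.Eventually.of_forall fun t => ?_))
    change nodeValues p τ (0, β₀ + t • v) k = _
    rw [nodeValues_zero, ← Finset.mul_prod_erase _ _ (Finset.mem_univ k)]
    congr 1
    simp [hβ₀]
  have hsurj : ((ContinuousLinearMap.fst ℝ ℝ (Fin p → ℝ)).prod F').range = ⊤ := by
    refine LinearMap.range_eq_top.2 (LinearMap.injective_iff_surjective.1 ?_)
    refine (injective_iff_map_eq_zero _).2 ?_
    rintro ⟨e, v⟩ h
    have he : e = 0 := congrArg Prod.fst h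
    subst he
    have hv : F' (0, v) = 0 := congrArg Prod.snd h
    have : v = 0 := funext fun k => by
      have hk := congrFun hv k
      rw [hline, Pi.zero_apply, neg_mul, neg_eq_zero] at hk
      refine (mul_eq_zero.1 hk).resolve_right (Finset.prod_ne_zero_iff.2 fun l hl h => ?_)
      rw [sub_eq_zero] at h
      exact (Finset.ne_of_mem_erase hl) (Fin.ext (by exact_mod_cast h.symm))
    rw [this]; rfl
  have hmap := hG'.map_nhds_eq_of_surj hsurj
  have hG0 : G x₀ = (0, 0) := by
    refine Prod.ext rfl (funext fun k => ?_)
    change nodeValues p τ (0, β₀) k = 0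
    rw [nodeValues_zero]
    exact Finset.prod_eq_zero (Finset.mem_univ k) (by simp [hβ₀])
  have hmem : Set.range G ∈ nhds ((0 : ℝ), (0 : Fin p → ℝ)) := by
    rw [← hG0, ← hmap]
    exact Filter.range_mem_map
  have hc : Filter.Tendsto (fun ε : ℝ => (ε, (0 : Fin p → ℝ))) (nhds 0) (nhds (0, 0)) :=
    (Continuous.prodMk_left (0 : Fin p → ℝ)).tendsto 0
  filter_upwards [hc hmem] with ε hε
  obtain ⟨⟨ε', β⟩, h⟩ := hε
  have h1 : ε' = ε := congrArg Prod.fst h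
  subst h1
  exact ⟨β, charpoly_scalarFloquet_eq hτ (congrArg Prod.snd h)⟩

/-- The direct sum of scalar operators: `a_n` is the constant matrix with diagonal `α`, and the
diagonal of `b_{r+1}` is `β · r` for `0 ≤ r < p`. -/
def diag [NeZero p] {m : ℕ} (α : Fin m → ℝ) (hα : ∀ i, α i ≠ 0) (β : Fin m → Fin p → ℝ) :
    PeriodicJacobi m p where
  a _ := diagonal α
  b n := diagonal fun i => β i (Fin.ofNat p ((n - 1) % p).toNat)
  a_periodic _ := rfl
  b_periodic n := by
    have : n + (p : ℤ) - 1 = n - 1 + p := by ring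
    rw [this, Int.add_emod_right]
  b_symm n := diagonal_transpose _
  a_det n := by
    rw [det_diagonal]
    exact Finset.prod_ne_zero_iff.2 fun i _ => hα i

theorem floquet_diag [NeZero p] {m : ℕ} (α : Fin m → ℝ) (hα : ∀ i, α i ≠ 0)
    (β : Fin m → Fin p → ℝ) (τ : ℂ) : (diag α hα β).floquet τ τ⁻¹ =
      blockDiagonal fun i => scalarFloquet (α i) (β i) τ := by
  ext ⟨r, i⟩ ⟨k, j⟩
  have hr : Fin.ofNat p ((((r : ℕ) : ℤ) + 1 - 1) % p).toNat = r := by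
    rw [add_sub_cancel_right, Int.emod_eq_of_lt (Int.natCast_nonneg _) (by exact_mod_cast r.2),
      Int.toNat_natCast]
    exact Fin.ext (Nat.mod_eq_of_lt r.2)
  rw [floquet_apply, blockDiagonal_apply]
  simp only [diag, hr]
  by_cases hij : i = j
  · subst hij
    simp only [scalarFloquet, diagonal_apply_eq, if_true, Matrix.add_apply, Matrix.smul_apply,
      transpose_apply, smul_eq_mul, diagonal_apply, Complex.coe_algebraMap]
    ring
  · simp [diagonal_apply_ne _ (Ne.symm hij), hij]

theorem charpoly_floquet_diag [NeZero p] {m : ℕ} (α : Fin m → ℝ) (hα : ∀ i, α i ≠ 0)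
    (β : Fin m → Fin p → ℝ) (τ : ℂ) : ((diag α hα β).floquet τ τ⁻¹).charpoly =
      ∏ i, (scalarFloquet (α i) (β i) τ).charpoly := by
  rw [floquet_diag, Matrix.charpoly]
  have : charmatrix (blockDiagonal fun i => scalarFloquet (α i) (β i) τ) =
      blockDiagonal fun i => charmatrix (scalarFloquet (α i) (β i) τ) := by
    ext1 ⟨r, i⟩ ⟨k, j⟩
    rw [charmatrix_apply, blockDiagonal_apply, blockDiagonal_apply]
    by_cases hij : i = j
    · subst hij
      simp [charmatrix_apply, diagonal_apply]
    · simp [hij]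
  rw [this, det_blockDiagonal]
  rfl

theorem exists_le_card_eq {α : Type*} (s : Multiset α) {n : ℕ} (h : n ≤ s.card) :
    ∃ t ≤ s, t.card = n := by
  induction s using Quotient.inductionOn with
  | h l => exact ⟨(l.take n : List α), (List.take_sublist n l).subperm, by simpa using h⟩

theorem card_roots_scalarFloquet (ε : ℝ) (β : Fin p → ℝ) (τ : ℂ) :
    (scalarFloquet ε β τ).charpoly.roots.card = p := by
  rw [← (IsAlgClosed.splits _).natDegree_eq_card_roots, charpoly_natDegree_eq_dim, Fintype.card_fin]

/-- A direct sum of a scalar operator with coefficients `ε`, `β` and `m` copies of the free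
operator. -/
def family [NeZero p] (m : ℕ) {ε : ℝ} (hε : ε ≠ 0) (β : Fin p → ℝ) : PeriodicJacobi (m + 1) p :=
  diag (Fin.cons ε fun _ => 1) (Fin.cases hε fun _ => one_ne_zero) (Fin.cons β fun _ => 0)

theorem zeros_family [NeZero p] (m : ℕ) {ε : ℝ} (hε : ε ≠ 0) (β : Fin p → ℝ) {τ : ℂ} (hτ : τ ≠ 0) :
    (family m hε β).zeros τ = (scalarFloquet ε β τ).charpoly.roots +
      m • (scalarFloquet 1 (0 : Fin p → ℝ) τ).charpoly.roots := by
  rw [zeros_eq _ hτ, family, charpoly_floquet_diag, Fin.prod_univ_succ]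
  simp only [Fin.cons_zero, Fin.cons_succ, Finset.prod_const, Finset.card_univ, Fintype.card_fin]
  rw [roots_mul, roots_pow]
  exact mul_ne_zero (charpoly_monic _).ne_zero (pow_ne_zero _ (charpoly_monic _).ne_zero)

/-- The leading coefficient of `D` in `z` determines `ε`. -/
theorem eq_of_D_family_eq [NeZero p] {m : ℕ} {ε ε' : ℝ} (hε : 0 < ε) (hε' : 0 < ε')
    {β β' : Fin p → ℝ}
    (h : ∀ z τ : ℂ, (family m hε.ne' β).D z τ = (family m hε'.ne' β').D z τ) : ε = ε' := by
  have h1 : (family m hε.ne' β).D (X : ℂ[X]) (C 1) = (family m hε'.ne' β').D (X : ℂ[X]) (C 1) :=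
    Polynomial.funext fun z => by rw [D_eval, D_eval, h]
  rw [D_X_eq_charpoly _ one_ne_zero, D_X_eq_charpoly _ one_ne_zero] at h1
  have h2 := congrArg leadingCoeff h1
  simp only [leadingCoeff_mul, leadingCoeff_C, (charpoly_monic _).leadingCoeff, one_pow, mul_one,
    Complex.ofReal_inj] at h2
  have hc : ∀ {ε : ℝ} (hε : ε ≠ 0) (β : Fin p → ℝ), (family m hε β).detConst =
      (-1) ^ (p * (m + 1)) * (cycSign (m + 1) p * ε ^ p)⁻¹ := fun hε β => by
    simp [detConst, family, diag, det_diagonal, Fin.prod_univ_succ]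
  rw [hc, hc] at h2
  have h3 := mul_left_cancel₀ (pow_ne_zero _ (by norm_num)) h2
  have h4 := mul_left_cancel₀ cycSign_ne_zero (inv_inj.1 h3)
  exact (pow_left_inj₀ hε.le hε'.le (NeZero.ne p)).1 h4

/-- Only the scalar summand of the members of `family` changes. For all small `ε` its diagonal
coefficients can be chosen with the same zeros at `e^{iϰ_0}`. The `m` free summands provide `mp`
common zeros at the other `e^{iϰ_j}`: one too few for `j = 1`, and enough for `j ≥ 2`. -/
theorem exists_data_infinite [NeZero p] (m : ℕ) (ϰ : Fin (m + 1 + 1) → ℝ) :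
    ∃ (Λ : Fin (m + 1 + 1) → Multiset ℂ) (Λ₁' : Multiset ℂ),
      (∀ j, j ≠ 0 → (Λ j).card = (m + 1 - (j : ℕ)) * p + 1) ∧
      (∃ J : PeriodicJacobi (m + 1) p, J.HasData ϰ Λ) ∧
      Λ₁' ≤ Λ 1 ∧ Λ₁'.card + 1 = (Λ 1).card ∧
      {F : ℂ → ℂ → ℂ | ∃ J : PeriodicJacobi (m + 1) p,
        J.HasData ϰ (Function.update Λ 1 Λ₁') ∧ F = fun z τ => J.D z τ}.Infinite := by
  have hp := Nat.pos_of_ne_zero (NeZero.ne p)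
  set e : Fin (m + 1 + 1) → ℂ := fun j => Complex.exp (ϰ j * Complex.I) with he
  have he1 : ∀ j, ‖e j‖ = 1 := fun j => Complex.norm_exp_ofReal_mul_I _
  have he0 : ∀ j, e j ≠ 0 := fun j => Complex.exp_ne_zero _
  -- the part of the zeros which does not depend on the member of the family
  set B : Fin (m + 1 + 1) → Multiset ℂ := fun j =>
    m • (scalarFloquet 1 (0 : Fin p → ℝ) (e j)).charpoly.roots with hB
  have hBcard : ∀ j, (B j).card = m * p := fun j => by
    rw [hB, Multiset.card_nsmul, card_roots_scalarFloquet]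
  obtain ⟨δ, hδ, hball⟩ := Metric.eventually_nhds_iff.1
    (eventually_exists_charpoly_eq (p := p) (he1 0))
  have hball' : ∀ ε : ℝ, 0 < ε → ε < δ → ∃ β : Fin p → ℝ,
      (scalarFloquet ε β (e 0)).charpoly = ∏ k : Fin p, (X - C ((k : ℕ) : ℂ)) :=
    fun ε h0 h1 => hball (by rwa [Real.dist_eq, sub_zero, abs_of_pos h0])
  choose! β hβ using hball'
  have hδ2 : 0 < δ / 2 := half_pos hδ
  set J₀ := family m hδ2.ne' (β (δ / 2)) with hJ₀
  obtain ⟨x, hx⟩ : ∃ x, x ∈ (scalarFloquet (δ / 2) (β (δ / 2)) (e 1)).charpoly.roots :=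
    Multiset.card_pos_iff_exists_mem.1 (by rw [card_roots_scalarFloquet]; exact hp)
  have hsub : ∀ j : Fin (m + 1 + 1), ∃ t ≤ B j,
      1 < (j : ℕ) → t.card = (m + 1 - (j : ℕ)) * p + 1 := by
    intro j
    by_cases hj : 1 < (j : ℕ)
    · obtain ⟨t, ht, hc⟩ := exists_le_card_eq (B j) (n := (m + 1 - (j : ℕ)) * p + 1) (by
        rw [hBcard]
        have h1 : m = m + 1 - (j : ℕ) + ((j : ℕ) - 1) := by have := j.2; omega
        have h2 : 1 ≤ ((j : ℕ) - 1) * p := Nat.mul_pos (by omega) hp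
        calc (m + 1 - (j : ℕ)) * p + 1 ≤ (m + 1 - (j : ℕ)) * p + ((j : ℕ) - 1) * p := by omega
          _ = m * p := by rw [← add_mul, ← h1])
      exact ⟨t, ht, fun _ => hc⟩
    · exact ⟨0, Multiset.zero_le _, fun h => absurd h hj⟩
  choose t ht htc using hsub
  set Λ : Fin (m + 1 + 1) → Multiset ℂ := fun j =>
    if j = 0 then (∏ k : Fin p, (X - C ((k : ℕ) : ℂ))).roots + B 0
    else if j = 1 then x ::ₘ B 1 else t j with hΛ
  have h10 : (1 : Fin (m + 1 + 1)) ≠ 0 := by simp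
  have hΛ1 : Λ 1 = x ::ₘ B 1 := by simp [hΛ]
  have hzeros : ∀ {ε : ℝ} (hε : ε ≠ 0) (β : Fin p → ℝ) j, (family m hε β).zeros (e j) =
      (scalarFloquet ε β (e j)).charpoly.roots + B j := fun hε β j => zeros_family m hε β (he0 j)
  refine ⟨Λ, B 1, fun j hj => ?_, ⟨J₀, ?_, fun j hj => ?_⟩, ?_, ?_, ?_⟩
  · by_cases hj1 : j = 1
    · subst hj1
      rw [hΛ1, Multiset.card_cons, hBcard]
      simp
    · have : 1 < (j : ℕ) := by
        have h0 : (j : ℕ) ≠ 0 := fun h => hj (Fin.ext h)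
        have h1 : (j : ℕ) ≠ 1 := fun h => hj1 (Fin.ext (by simpa using h))
        omega
      simp only [hΛ, if_neg hj, if_neg hj1]
      exact htc j this
  · change Λ 0 = J₀.zeros (e 0)
    rw [hJ₀, hzeros, hβ _ hδ2 (half_lt_self hδ)]
    simp [hΛ]
  · change Λ j ≤ J₀.zeros (e j)
    rw [hJ₀, hzeros]
    by_cases hj1 : j = 1
    · subst hj1
      rw [hΛ1, ← Multiset.singleton_add]
      exact add_le_add_left (Multiset.singleton_le.2 hx) _
    · simp only [hΛ, if_neg hj, if_neg hj1]
      exact (ht j).trans (Multiset.le_add_left _ _)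
  · rw [hΛ1]
    exact Multiset.le_cons_self _ _
  · rw [hΛ1, Multiset.card_cons]
  · -- the determinants of the members of the family are pairwise different
    let f : ℝ → ℂ → ℂ → ℂ := fun ε z τ =>
      if h : 0 < ε then (family m h.ne' (β ε)).D z τ else 0
    have hinj : Set.InjOn f (Set.Ioo 0 δ) := by
      intro ε hε ε' hε' h
      refine eq_of_D_family_eq (m := m) hε.1 hε'.1 (β := β ε) (β' := β ε') fun z τ => ?_
      have := congrFun (congrFun h z) τ
      simpa only [f, dif_pos hε.1, dif_pos hε'.1] using this
    refine ((Set.Ioo_infinite hδ).image hinj).mono ?_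
    rintro _ ⟨ε, hε, rfl⟩
    refine ⟨family m hε.1.ne' (β ε), ⟨?_, fun j hj => ?_⟩, ?_⟩
    · change Function.update Λ 1 (B 1) 0 = (family m hε.1.ne' (β ε)).zeros (e 0)
      rw [Function.update_of_ne h10.symm, hzeros, hβ _ hε.1 hε.2]
      simp [hΛ]
    · change Function.update Λ 1 (B 1) j ≤ (family m hε.1.ne' (β ε)).zeros (e j)
      rw [hzeros]
      by_cases hj1 : j = 1
      · subst hj1
        rw [Function.update_self]
        exact Multiset.le_add_left _ _
      · rw [Function.update_of_ne hj1]
        simp only [hΛ, if_neg hj, if_neg hj1]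
        exact (ht j).trans (Multiset.le_add_left _ _)
    · funext z τ
      simp only [f, dif_pos hε.1]

end

end PeriodicJacobi

theorem theorem1p3 (m p : ℕ) [NeZero p] (hm : 1 ≤ m) (ϰ : Fin (m + 1) → ℝ)
    (hϰ : ∀ i j, i ≠ j → Real.cos (ϰ i) ≠ Real.cos (ϰ j)) :
    (∀ Λ : Fin (m + 1) → Multiset ℂ,
      (∀ j, j ≠ 0 → (Λ j).card = (m - (j : ℕ)) * p + 1) →
      ∀ J J' : PeriodicJacobi m p, J.HasData ϰ Λ → J'.HasData ϰ Λ →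
        (∀ z τ : ℂ, J.D z τ = J'.D z τ) ∧
        (∀ Δ : Fin m → ℂ → ℂ, J.IsLyapunov Δ ↔ J'.IsLyapunov Δ) ∧
        spectrum ℂ J.op = spectrum ℂ J'.op ∧
        (∀ z : ℂ, J.multiplicity z = J'.multiplicity z)) ∧
    (∃ (Λ : Fin (m + 1) → Multiset ℂ) (Λ₁' : Multiset ℂ),
      (∀ j, j ≠ 0 → (Λ j).card = (m - (j : ℕ)) * p + 1) ∧
      (∃ J : PeriodicJacobi m p, J.HasData ϰ Λ) ∧
      Λ₁' ≤ Λ 1 ∧ Λ₁'.card + 1 = (Λ 1).card ∧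
      {F : ℂ → ℂ → ℂ | ∃ J : PeriodicJacobi m p,
        J.HasData ϰ (Function.update Λ 1 Λ₁') ∧ F = fun z τ => J.D z τ}.Infinite) := by
  constructor
  · intro Λ hΛ J J' hJ hJ'
    have hD : ∀ z τ : ℂ, J.D z τ = J'.D z τ :=
      PeriodicJacobi.D_eq_of_hasData hϰ hΛ hJ hJ'
    refine ⟨hD, PeriodicJacobi.isLyapunov_iff_of_D_eq hD, ?_,
      PeriodicJacobi.multiplicity_eq_of_D_eq hD⟩
    ext z
    simp only [PeriodicJacobi.mem_spectrum_op_iff, hD]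
  · obtain ⟨m, rfl⟩ := Nat.exists_eq_add_of_le' hm
    exact PeriodicJacobi.exists_data_infinite m ϰ
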